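/- **Proposition 3.3.** Let $k$ be an algebraically closed field and let $C$ be a nodal curve of compact type over $k$ (reduced, connected, proper, nodal, with dual graph a tree), with irreducible components $C_i$, $i=1,\dots,M$ (smooth projective curves) and nodes $P_\alpha$, $\alpha=1,\dots,M-1$; write $P_\alpha\in C_{j_1(\alpha)}\cap C_{j_2(\alpha)}$. Let $r\ge 0$ and $d$ be integers. If $V$ is an $(r+1)$-dimensional space of sections of a line bundle on $C_j$ and $P_\alpha\in C_j$, the sections in $V$ have exactly $r+1$ distinct orders of vanishing at $P_\alpha$; they are listed in decreasing order, $u_0(j,\alpha)>\dots>u_r(j,\alpha)$. A *limit linear series* of degree $d$ and dimension $r$ on $C$ consists of a line bundle $L_i$ of degree $d$ on each $C_i$ and an $(r+1)$-dimensional subspace $V_i\subset H^0(C_i,L_i)$ such that, for all nodes $P_\alpha$ and all $t=0,\dots,r$, the orders of vanishing satisfy $u_t(j_1(\alpha),\alpha)+u_{r-t}(j_2(\alpha),\alpha)\ge d$. It is *refined* if equality holds for all nodes and all $t$. An *effective linear series* of degree $d$ and dimension $r$ on $C$ consists of a line bundle $L_{i,i}$ of some degree $d_i$ on each $C_i$,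 an $(r+1)$-dimensional subspace $W_i\subset H^0(C_i,L_{i,i})$, and for each node an integer $a_\alpha$ with $r\le a_\alpha\le d_{j_1(\alpha)}$ and $a_\alpha\le d_{j_2(\alpha)}$, such that (a) $\sum_i d_i-\sum_\alpha a_\alpha=d$; (b) the orders of vanishing $w_t(j,\alpha)$ of the sections of $W_j$ satisfy $w_t(j_1(\alpha),\alpha)+w_{r-t}(j_2(\alpha),\alpha)\ge a_\alpha$ for all nodes and all $t=0,\dots,r$; (c) for each $C_j$ and each node $P_\alpha$ on $C_j$, some nonzero section in $W_j$ vanishes at $P_\alpha$ to order at least $a_\alpha$. It is *refined* if equality holds in (b) for all nodes and all $t$. In both cases, an isomorphism is a family of isomorphisms of the line bundles on the components taking the spaces of sections to one another (and, for effective series, the integers $a_\alpha$ are the same). Then there is a bijection between isomorphism classes of refined limit linear series of degree $d$ and dimension $r$ on $C$ and isomorphism classes of refined effective linear series of degree $d$ and dimension $r$ on $C$, given by the following mutually inverse constructions. * To $(L_i,V_i)_i$ corresponds $$L_{i,i}=L_i\Big(-\sum_{P_\alpha\in C_i}u_r(i,\alpha)P_\alpha\Big),\qquad a_\alpha=d-u_r(j_1(\alpha),\alpha)-u_r(j_2(\alpha),\alpha),$$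 with $W_i$ the space $V_i$ regarded as a space of sections of $L_{i,i}$. * To $(L_{i,i},W_i,a_\alpha)$ corresponds $$L_i=L_{i,i}\Big(\sum_{P_\alpha\in C_i}d'_{i,\alpha}P_\alpha\Big),\qquad d'_{i,\alpha}=\sum_{C_m\subset \overline X_{i,\alpha}}d_m-\sum_{P_\beta\in \overline X_{i,\alpha}}a_\beta,$$ where $\overline X_{i,\alpha}$ is the closure of the connected component $X_{i,\alpha}$ of $C\setminus C_i$ attached to $C_i$ at $P_\alpha$ (so that $P_\alpha\in\overline X_{i,\alpha}$). The integers $d'_{i,\alpha}$ are nonnegative, and $V_i$ is the space $W_i$ regarded as a space of sections of $L_i$, that is, with additional base points of multiplicity $d'_{i,\alpha}$ at the $P_\alpha$. In particular, these constructions yield refined series of the indicated kind. -/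

import Mathlib

open CategoryTheory CategoryTheory.Limits AlgebraicGeometry

universe u v

noncomputable section

namespace LimitSeries

/-! ### Line bundles on integral schemes, orders of vanishing, degree -/

section LineBundle

variable {X : Scheme.{u}}

/-- Restriction of a section of an `𝒪_X`-module to a smaller open set. -/
def res (L : X.Modules) {U V : X.Opens} (h : V ≤ U) (s : Γ(L, U)) : Γ(L, V) :=
  L.presheaf.map (homOfLE h).op s

/-- `e` is a nowhere vanishing section of `L` over `U` trivialising `L` there: multiplication by
`e` is an isomorphism `𝒪_X|_U ≅ L|_U`. -/
def IsGenerator (L : X.Modules) {U : X.Opens} (e : Γ(L, U)) : Prop :=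
  ∀ (V : X.Opens) (h : V ≤ U), Function.Bijective (fun f : Γ(X, V) => f • res L h e)

/-- A line bundle (invertible sheaf): a sheaf of `𝒪_X`-modules locally isomorphic to `𝒪_X`. -/
def IsLineBundle (L : X.Modules) : Prop :=
  ∀ x : X, ∃ U : X.Opens, x ∈ U ∧ ∃ e : Γ(L, U), IsGenerator L e

variable [IsIntegral X] [IsLocallyNoetherian X]

/-- The nonzero section `s` of the line bundle `L` over the nonempty open set `U`, regarded as a
rational section of `L`, has order `n` at the point `x` (which need not lie in `U`):
with respect to a generator `e` of `L` near `x` one has `s = g e` for a rational function `g`,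
and `g` has order `n` at `x`. -/
def HasOrd (L : X.Modules) {U : X.Opens} (s : Γ(L, U)) (x : X) (n : ℤ) : Prop :=
  ∃ (V : X.Opens) (_ : x ∈ V) (e : Γ(L, V)) (_ : IsGenerator L e)
    (W : X.Opens) (_ : Nonempty W) (hU : W ≤ U) (hV : W ≤ V) (g : Γ(X, W)),
    res L hU s = g • res L hV e ∧ Scheme.ord (X.germToFunctionField W g) x = n

/-- The order at `x` of a nonzero rational section `s` of a line bundle (the unique integer `n`
with `HasOrd L s x n`). -/
def ordAt (L : X.Modules) {U : X.Opens} (s : Γ(L, U)) (x : X) : ℤ :=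
  Classical.epsilon fun n => HasOrd L s x n

/-- The section `s` vanishes to order at least `n` at `x`. -/
def VanishesToOrder (L : X.Modules) {U : X.Opens} (s : Γ(L, U)) (x : X) (n : ℤ) : Prop :=
  s = 0 ∨ n ≤ ordAt L s x

/-- The line bundle `L` has degree `d`: the divisor of each nonzero rational section of `L`
(a nonzero section over some nonempty open set) has degree `d`. Used for complete curves over
an algebraically closed field only, where all closed points have degree one and where this degree
does not depend on the rational section. -/
def HasDegree (L : X.Modules) (d : ℤ) : Prop :=
  ∀ (U : X.Opens) (s : Γ(L, U)), s ≠ 0 → ∑ᶠ x : X, ordAt L s x = d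

end LineBundle

/-! ### Smooth projective curves -/

/-- An irreducible smooth projective curve over the (algebraically closed) field `k`: an integral
scheme, proper over `k`, whose local rings at closed points are regular of dimension one. -/
structure SmoothCurve (k : Type u) [Field k] where
  X : Scheme.{u}
  str : X ⟶ Spec (.of k)
  isIntegral : IsIntegral X
  isProper : IsProper str
  isDVR : ∀ x : X, IsClosed {x} → IsDiscreteValuationRing (X.presheaf.stalk x)

namespace SmoothCurve

variable {k : Type u} [Field k] (Y : SmoothCurve k)

instance : IsIntegral Y.X := Y.isIntegral

instance : IsProper Y.str := Y.isProper

instance : IsLocallyNoetherian Y.X :=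
  LocallyOfFiniteType.isLocallyNoetherian Y.str

/-- The structure map from `k` to the global functions. -/
def scalars : k →+* Γ(Y.X, ⊤) :=
  Y.str.appTop.hom.comp (Scheme.ΓSpecIso (.of k)).inv.hom

/-- The `k`-vector space `H⁰(Y, L)` of global sections. -/
def H0 (L : Y.X.Modules) : Type u := Γ(L, ⊤)

instance (L : Y.X.Modules) : AddCommGroup (Y.H0 L) :=
  inferInstanceAs (AddCommGroup Γ(L, ⊤))

instance (L : Y.X.Modules) : Module k (Y.H0 L) :=
  letI : Module Γ(Y.X, ⊤) (Y.H0 L) := inferInstanceAs (Module Γ(Y.X, ⊤) Γ(L, ⊤))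
  Module.compHom _ Y.scalars

/-- The map induced on global sections by a morphism of `𝒪`-modules. -/
def H0map {L L' : Y.X.Modules} (φ : L' ⟶ L) : Y.H0 L' →ₗ[k] Y.H0 L where
  toFun s := φ.app ⊤ s
  map_add' s t := map_add (φ.app ⊤).hom s t
  map_smul' c s := Scheme.Modules.Hom.app_smul φ (Y.scalars c) s

/-- The order of vanishing at `x` of a nonzero global section. -/
def ord {L : Y.X.Modules} (s : Y.H0 L) (x : Y.X) : ℤ :=
  ordAt L (U := ⊤) s x

/-- The set of orders of vanishing at `x` of the nonzero sections in `V`. -/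
def orders {L : Y.X.Modules} (V : Submodule k (Y.H0 L)) (x : Y.X) : Set ℕ :=
  {n | ∃ s ∈ V, s ≠ 0 ∧ Y.ord s x = n}

/-- The `t`-th order of vanishing `u_t` at `x` of an `(r+1)`-dimensional space `V` of sections,
where the `r+1` distinct orders are listed decreasingly, `u_0 > ⋯ > u_r`. So `u_t` is the
`(r - t)`-th smallest order, counting from `0`. -/
def vanishingOrder {L : Y.X.Modules} (V : Submodule k (Y.H0 L)) (x : Y.X) (r t : ℕ) : ℕ :=
  Nat.nth (fun n => n ∈ Y.orders V x) (r - t)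

/-- `(L', V')` is obtained from `(L, V)` by the twist `L' = L(-∑ n_c p_c)` (`n_c ≥ 0`, the points
`p_c` being distinct) and by regarding the sections in `V` as sections of `L'`. That is, there is
an isomorphism of `L'` onto the subsheaf of `L` of sections vanishing to order at least `n_c` at
each `p_c`, and it takes `V'` onto `V`. Equivalently `L = L'(∑ n_c p_c)`, and `V` is the same space
of sections as `V'` with additional base points of multiplicity `n_c` at `p_c`. -/
def IsTwist {κ : Type v} (p : κ → Y.X) (n : κ → ℕ)
    (L : Y.X.Modules) (V : Submodule k (Y.H0 L))
    (L' : Y.X.Modules) (V' : Submodule k (Y.H0 L')) : Prop :=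
  ∃ φ : L' ⟶ L,
    (∀ U : Y.X.Opens, Function.Injective (φ.app U)) ∧
    (∀ (U : Y.X.Opens) (s : Γ(L, U)), (∃ s' : Γ(L', U), φ.app U s' = s) ↔
      ∀ c, p c ∈ U → VanishesToOrder L s (p c) (n c)) ∧
    V'.map (Y.H0map φ) = V

end SmoothCurve

/-! ### Curves of compact type -/

/-- The graph in which `i ≠ j` are adjacent when the images of `f_i` and `f_j` meet. -/
def intersectionGraph {ι : Type v} {C : Scheme.{u}} {X : ι → Scheme.{u}} (f : ∀ i, X i ⟶ C) :
    SimpleGraph ι where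
  Adj i j := i ≠ j ∧ ∃ (x : X i) (y : X j), f i x = f j y
  symm := ⟨by
    rintro i j ⟨hij, x, y, e⟩
    exact ⟨hij.symm, y, x, e.symm⟩⟩
  loopless := ⟨fun _ h => h.1 rfl⟩

/-- A nodal curve of compact type over the (algebraically closed) field `k`, with irreducible
components indexed by `ι`: a reduced proper scheme `C` over `k` that is the union of smooth
projective curves `C_i ⊆ C`, such that any two components are disjoint or meet transversally in a
single point (their scheme-theoretic intersection is empty or a reduced `k`-point), no point lies
on three components, and the dual graph is a tree. -/
structure CompactTypeCurve (k : Type u) [Field k] (ι : Type v) where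
  C : Scheme.{u}
  str : C ⟶ Spec (.of k)
  isReduced : IsReduced C
  isProper : IsProper str
  comp : ι → SmoothCurve k
  incl : ∀ i, (comp i).X ⟶ C
  isClosedImmersion : ∀ i, IsClosedImmersion (incl i)
  incl_str : ∀ i, incl i ≫ str = (comp i).str
  covers : ∀ x : C, ∃ i, ∃ y : (comp i).X, incl i y = x
  transversal : ∀ i j, i ≠ j → IsEmpty (pullback (incl i) (incl j) : Scheme.{u}) ∨
    IsIso (pullback.fst (incl i) (incl j) ≫ (comp i).str)
  no_triple : ∀ (i j l : ι) (x : (comp i).X) (y : (comp j).X) (z : (comp l).X),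
    incl i x = incl j y → incl i x = incl l z → i = j ∨ i = l ∨ j = l
  isTree : (intersectionGraph incl).IsTree

namespace CompactTypeCurve

variable {k : Type u} [Field k] {ι : Type v} (C : CompactTypeCurve k ι)

/-- The dual graph: its vertices are the components, its edges the nodes of the curve. -/
abbrev dualGraph : SimpleGraph ι :=
  intersectionGraph C.incl

/-- For adjacent components `C_i`, `C_j`, the point of `C_i` that is identified with a point of
`C_j` to form the node joining them. -/
def pt {i j : ι} (h : C.dualGraph.Adj i j) : (C.comp i).X :=
  h.2.choose

/-- The node of `C` joining the adjacent components `C_i` and `C_j`, as an edge. -/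
def node {i j : ι} (h : C.dualGraph.Adj i j) : C.dualGraph.edgeSet :=
  ⟨s(i, j), h⟩

/-- The components in the connected component of `C ∖ C_i` that is attached to `C_i` at the node
joining `C_i` and `C_j`. -/
def branch {i j : ι} (_ : C.dualGraph.Adj i j) : Set ι :=
  {m | ∃ p : C.dualGraph.Walk j m, i ∉ p.support}

/-- The nodes in the closure of that connected component: those on one of its components. -/
def branchNodes {i j : ι} (h : C.dualGraph.Adj i j) : Set C.dualGraph.edgeSet :=
  {α | ∃ m ∈ C.branch h, m ∈ α.1}

end CompactTypeCurve

/-! ### Limit linear series and effective linear series -/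

variable {k : Type u} [Field k] {ι : Type v}

/-- An Eisenbud–Harris limit linear series of degree `d` and (projective) dimension `r`. -/
structure LimitLinearSeries (C : CompactTypeCurve k ι) (r : ℕ) (d : ℤ) where
  L : ∀ i, (C.comp i).X.Modules
  isLineBundle : ∀ i, IsLineBundle (L i)
  hasDegree : ∀ i, HasDegree (L i) d
  V : ∀ i, Submodule k ((C.comp i).H0 (L i))
  finrank_V : ∀ i, Module.finrank k (V i) = r + 1
  le_add : ∀ {i j : ι} (h : C.dualGraph.Adj i j) (t : ℕ), t ≤ r →
    d ≤ (C.comp i).vanishingOrder (V i) (C.pt h) r t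
      + (C.comp j).vanishingOrder (V j) (C.pt h.symm) r (r - t)

namespace LimitLinearSeries

variable {C : CompactTypeCurve k ι} {r : ℕ} {d : ℤ}

/-- The orders `u_0 > ⋯ > u_r` of vanishing of the sections in `V_i` at the node joining `C_i`
and `C_j`. -/
def u (S : LimitLinearSeries C r d) {i j : ι} (h : C.dualGraph.Adj i j) (t : ℕ) : ℕ :=
  (C.comp i).vanishingOrder (S.V i) (C.pt h) r t

/-- The series is refined. -/
def IsRefined (S : LimitLinearSeries C r d) : Prop :=
  ∀ {i j : ι} (h : C.dualGraph.Adj i j) (t : ℕ), t ≤ r →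
    (S.u h t : ℤ) + S.u h.symm (r - t) = d

/-- Isomorphism of limit linear series: isomorphisms of the line bundles carrying the spaces of
sections to one another. -/
def Iso (S T : LimitLinearSeries C r d) : Prop :=
  ∀ i, ∃ φ : S.L i ≅ T.L i, (S.V i).map ((C.comp i).H0map φ.hom) = T.V i

end LimitLinearSeries

/-- An effective linear series of degree `d` and dimension `r`. -/
structure EffectiveLinearSeries (C : CompactTypeCurve k ι) (r : ℕ) (d : ℤ) where
  L : ∀ i, (C.comp i).X.Modules
  isLineBundle : ∀ i, IsLineBundle (L i)
  deg : ι → ℤ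
  hasDegree : ∀ i, HasDegree (L i) (deg i)
  W : ∀ i, Submodule k ((C.comp i).H0 (L i))
  finrank_W : ∀ i, Module.finrank k (W i) = r + 1
  a : C.dualGraph.edgeSet → ℤ
  le_a : ∀ α, (r : ℤ) ≤ a α
  a_le_deg : ∀ {i j : ι} (h : C.dualGraph.Adj i j), a (C.node h) ≤ deg i
  sum_deg : ∑ᶠ i, deg i - ∑ᶠ α, a α = d
  le_add : ∀ {i j : ι} (h : C.dualGraph.Adj i j) (t : ℕ), t ≤ r →
    a (C.node h) ≤ (C.comp i).vanishingOrder (W i) (C.pt h) r t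
      + (C.comp j).vanishingOrder (W j) (C.pt h.symm) r (r - t)
  exists_section : ∀ {i j : ι} (h : C.dualGraph.Adj i j),
    ∃ s ∈ W i, s ≠ 0 ∧ a (C.node h) ≤ (C.comp i).ord s (C.pt h)

namespace EffectiveLinearSeries

variable {C : CompactTypeCurve k ι} {r : ℕ} {d : ℤ}

/-- The orders `w_0 > ⋯ > w_r` of vanishing of the sections in `W_i` at the node joining `C_i`
and `C_j`. -/
def w (T : EffectiveLinearSeries C r d) {i j : ι} (h : C.dualGraph.Adj i j) (t : ℕ) : ℕ :=
  (C.comp i).vanishingOrder (T.W i) (C.pt h) r t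

/-- The series is refined. -/
def IsRefined (T : EffectiveLinearSeries C r d) : Prop :=
  ∀ {i j : ι} (h : C.dualGraph.Adj i j) (t : ℕ), t ≤ r →
    (T.w h t : ℤ) + T.w h.symm (r - t) = T.a (C.node h)

/-- Isomorphism of effective linear series: the integers at the nodes agree, and there are
isomorphisms of the line bundles carrying the spaces of sections to one another. (The degrees of
the line bundles then agree as well.) -/
def Iso (S T : EffectiveLinearSeries C r d) : Prop :=
  S.a = T.a ∧ ∀ i, ∃ φ : S.L i ≅ T.L i, (S.W i).map ((C.comp i).H0map φ.hom) = T.W i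

/-- The multiplicity `d'` at the node joining `C_i` and `C_j`, on the side of `C_i`: the sum of
the degrees `d_m` over the components `C_m` in the connected component of `C ∖ C_i` attached there,
minus the sum of the `a_α` over the nodes in the closure of this connected component. -/
def d' (T : EffectiveLinearSeries C r d) {i j : ι} (h : C.dualGraph.Adj i j) : ℤ :=
  ∑ᶠ m ∈ C.branch h, T.deg m - ∑ᶠ α ∈ C.branchNodes h, T.a α

end EffectiveLinearSeries

variable {C : CompactTypeCurve k ι} {r : ℕ} {d : ℤ}

/-- `T` is the effective series attached to the limit series `S`:
`L_{i,i} = L_i(-∑_l u_r(i,l) P_{i,l})`, `W_i` is `V_i` regarded as a space of sections of `L_{i,i}`,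
and `a_α = d - u_r(j_1,α) - u_r(j_2,α)`. -/
def IsEffectiveOf (S : LimitLinearSeries C r d) (T : EffectiveLinearSeries C r d) : Prop :=
  (∀ i, (C.comp i).IsTwist (κ := C.dualGraph.neighborSet i)
    (fun j => C.pt j.2) (fun j => S.u j.2 r) (S.L i) (S.V i) (T.L i) (T.W i)) ∧
  ∀ {i j : ι} (h : C.dualGraph.Adj i j),
    T.a (C.node h) = d - S.u h r - S.u h.symm r

/-- `S` is the limit series attached to the effective series `T`:
`L_i = L_{i,i}(∑_l d'_{i,l} P_{i,l})`, where the `d'_{i,l}` are nonnegative, and `V_i` is `W_i` with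
additional base points of multiplicity `d'_{i,l}` at the `P_{i,l}`. -/
def IsLimitOf (T : EffectiveLinearSeries C r d) (S : LimitLinearSeries C r d) : Prop :=
  (∀ {i j : ι} (h : C.dualGraph.Adj i j), 0 ≤ T.d' h) ∧
  ∀ i, (C.comp i).IsTwist (κ := C.dualGraph.neighborSet i)
    (fun j => C.pt j.2) (fun j => (T.d' j.2).toNat) (S.L i) (S.V i) (T.L i) (T.W i)

/-- Refined limit linear series of degree `d` and dimension `r` up to isomorphism. -/
def RefinedLimitClasses (C : CompactTypeCurve k ι) (r : ℕ) (d : ℤ) :=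
  Quot fun S T : {S : LimitLinearSeries C r d // S.IsRefined} => S.1.Iso T.1

/-- Refined effective linear series of degree `d` and dimension `r` up to isomorphism. -/
def RefinedEffectiveClasses (C : CompactTypeCurve k ι) (r : ℕ) (d : ℤ) :=
  Quot fun S T : {T : EffectiveLinearSeries C r d // T.IsRefined} => S.1.Iso T.1

end LimitSeries

end

/-!
A line bundle `L` on a smooth curve embeds in the constant sheaf of rational functions, by taking
coordinates with respect to a nonzero rational section (`RationalEmbedding`); its image is `𝒪(-D)`
for a divisor `D` (`RationalEmbedding.HasDivisor`), and the order at `x` of the section given by a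
function `f` is `ord_x f - D x`. In these terms a pair `(L, V)` is a divisor `D` together with a
space of rational functions, up to multiplication by a rational function
(`exists_iso_map_eq_iff`), and a twist replaces `D` by `D + ∑ n_c p_c` and retains the space of
functions (`isTwist_iff`). Hence twists exist in both directions, are unique up to isomorphism,
shift the orders of vanishing at `p_c` by `n_c` and change the degree by `∑ n_c`. Every divisor `D`
occurs because `𝒪(-D)` can be written down as a sheaf of functions (`ofDivisor`). That an
`(r + 1)`-dimensional space of sections has `r + 1` orders at a closed point (`ncard_orders`) holds
because the residue field there is `k`.

The rest is bookkeeping on the dual tree. Removing an edge `ij` splits the tree into two branches,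
and removing a vertex `i` splits it into the branches at `i`. For an effective series this yields
`d'_{ij} + d'_{ji} = d - a_{ij}` and `deg_i + ∑_j d'_{ij} = d`, and so
`d'_{ij} = (deg_j - a_{ij}) + ∑_{l ≠ i} d'_{jl}`. By induction from the leaves inwards the `d'` are
nonnegative (`branchWeight_nonneg`), and they are the only solution of these equations
(`branchWeight_eq`).

In a refined effective series, `w_0 ≥ a` at each node, because some section vanishes to order at
least `a` there, and so `w_r = 0` on the other side of the node. After the twist by `d'`,
the last order of vanishing is therefore `u_r = w_r + d' = d'`. In the other direction `d'` and
`u_r` solve the same equations on the tree.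
So the two constructions twist by the same multiplicities (`isEffectiveOf_iff_isLimitOf`), and are
mutually inverse because twists are unique.
-/

noncomputable section

namespace LimitSeries

/-! ### Divisors of rational functions -/

namespace SmoothCurve

variable {k : Type u} [Field k] (Y : SmoothCurve k)

open Order TopologicalSpace

instance : CompactSpace Y.X :=
  (quasiCompact_iff_compactSpace Y.str).mp inferInstance

instance : IsNoetherian Y.X where

lemma coheight_eq_one {x : Y.X} (hx : IsClosed {x}) : coheight x = 1 := by
  have := Y.isDVR x hx
  have h := ringKrullDim_stalk_eq_coheight x
  rw [IsDiscreteValuationRing.ringKrullDim_eq_one] at h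
  exact_mod_cast h.symm

/-- The points of a curve are its closed points and its generic point. -/
lemma isClosed_or_eq_genericPoint (x : Y.X) : IsClosed {x} ∨ x = genericPoint Y.X := by
  obtain ⟨y, hy, hyc⟩ := (isClosed_closure (s := {x})).exists_closed_singleton
    ⟨x, subset_closure rfl⟩
  have hle : y ≤ x := specializes_iff_mem_closure.mpr hy
  by_cases hyx : y = x
  · exact .inl (hyx ▸ hyc)
  · right
    have hlt : y < x := lt_of_le_not_ge hle fun h =>
      hyx (Specializes.antisymm (show y ⤳ x from h) (show x ⤳ y from hle)).eq
    have h1 := coheight_strictAnti hlt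
    have h2 := Y.coheight_eq_one hyc
    have h0 : coheight x = 0 := by
      by_contra h0
      have h3 : 1 ≤ coheight x := Order.one_le_iff_pos.mpr (pos_iff_ne_zero.mpr h0)
      have h4 : coheight x < ⊤ := by
        refine lt_of_le_of_lt (coheight_anti hle) ?_
        rw [h2]; exact ENat.one_lt_top
      exact absurd (h1 h4) (by rw [h2]; exact not_lt.mpr h3)
    exact Specializes.antisymm (coheight_eq_zero.mp h0 (show x ≤ genericPoint Y.X from le_top))
      (genericPoint_specializes x) |>.eq

lemma coheight_genericPoint : coheight (genericPoint Y.X) = 0 :=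
  coheight_eq_zero.mpr (isMax_top (α := Y.X))

lemma not_isClosed_genericPoint : ¬ IsClosed {genericPoint Y.X} := fun h => by
  have := Y.coheight_eq_one h
  rw [coheight_genericPoint] at this
  exact zero_ne_one this

lemma ord_genericPoint (f : Y.X.functionField) : Scheme.ord f (genericPoint Y.X) = 0 :=
  Scheme.ord_eq_zero_of_coheight_neq_one (by rw [coheight_genericPoint]; exact zero_ne_one) f

lemma genericPoint_mem (U : Y.X.Opens) [h : Nonempty U] : genericPoint Y.X ∈ U :=
  ((genericPoint_spec Y.X).mem_open_set_iff U.isOpen).mpr (by simpa using h)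

instance (U V : Y.X.Opens) [Nonempty U] [Nonempty V] : Nonempty (U ⊓ V : Y.X.Opens) :=
  ⟨⟨genericPoint Y.X, Y.genericPoint_mem U, Y.genericPoint_mem V⟩⟩

instance : Nonempty (⊤ : Y.X.Opens) := ⟨⟨genericPoint Y.X, trivial⟩⟩

lemma finite_of_isClosed {Z : Set Y.X} (hZ : IsClosed Z) (h : genericPoint Y.X ∉ Z) :
    Z.Finite := by
  obtain ⟨S, hS, hSc, hSi, rfl⟩ := NoetherianSpace.exists_finite_set_isClosed_irreducible hZ
  refine hS.sUnion fun t ht => ?_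
  obtain ⟨z, hz⟩ := QuasiSober.sober (hSi t ht) (hSc t ht)
  have hzt : z ∈ t := hz.mem
  rcases Y.isClosed_or_eq_genericPoint z with hc | rfl
  · rw [← hz.def, hc.closure_eq]
    exact Set.finite_singleton z
  · exact absurd ⟨t, ht, hzt⟩ h

lemma isClosed_of_finite {Z : Set Y.X} (hZ : Z.Finite) (h : genericPoint Y.X ∉ Z) :
    IsClosed Z := by
  rw [← Set.biUnion_of_singleton Z]
  refine hZ.isClosed_biUnion fun x hx => ?_
  rcases Y.isClosed_or_eq_genericPoint x with hc | rfl
  · exact hc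
  · exact absurd hx h

lemma ord_one (x : Y.X) : Scheme.ord (1 : Y.X.functionField) x = 0 := by
  have := Scheme.ord_mul (x := x) (one_ne_zero (α := Y.X.functionField)) one_ne_zero
  rw [mul_one] at this
  omega

lemma ord_inv {f : Y.X.functionField} (hf : f ≠ 0) (x : Y.X) :
    Scheme.ord f⁻¹ x = - Scheme.ord f x := by
  have := Scheme.ord_mul (x := x) hf (inv_ne_zero hf)
  rw [mul_inv_cancel₀ hf, ord_one] at this
  omega

lemma ord_div {f g : Y.X.functionField} (hf : f ≠ 0) (hg : g ≠ 0) (x : Y.X) :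
    Scheme.ord (f / g) x = Scheme.ord f x - Scheme.ord g x := by
  rw [div_eq_mul_inv, Scheme.ord_mul hf (inv_ne_zero hg), ord_inv _ hg, sub_eq_add_neg]

lemma ord_zpow {f : Y.X.functionField} (hf : f ≠ 0) (n : ℤ) (x : Y.X) :
    Scheme.ord (f ^ n) x = n * Scheme.ord f x := by
  induction n with
  | zero => simp [ord_one]
  | succ n ih => rw [zpow_add_one₀ hf, Scheme.ord_mul (zpow_ne_zero _ hf) hf, ih]; ring
  | pred n ih =>
    rw [zpow_sub_one₀ hf, Scheme.ord_mul (zpow_ne_zero _ hf) (inv_ne_zero hf), ih, ord_inv _ hf]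
    ring

lemma ord_neg (f : Y.X.functionField) (x : Y.X) : Scheme.ord (-f) x = Scheme.ord f x := by
  by_cases hf : f = 0
  · simp [hf]
  have h1 : (-1 : Y.X.functionField) ≠ 0 := neg_ne_zero.mpr one_ne_zero
  have h2 := Scheme.ord_mul (x := x) h1 h1
  rw [neg_mul_neg, one_mul, ord_one] at h2
  rw [← neg_one_mul, Scheme.ord_mul h1 hf]
  omega

lemma min_le_ord_add {f g : Y.X.functionField} (hfg : f + g ≠ 0) (x : Y.X) :
    min (Scheme.ord f x) (Scheme.ord g x) ≤ Scheme.ord (f + g) x := by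
  rcases Y.isClosed_or_eq_genericPoint x with hc | rfl
  · have := Y.isDVR x hc
    exact Scheme.ord_add hfg
  · simp [ord_genericPoint]

/-- The local ring at `x` consists of the rational functions of nonnegative order at `x`. -/
lemma ord_nonneg_iff {f : Y.X.functionField} (hf : f ≠ 0) (x : Y.X) :
    0 ≤ Scheme.ord f x ↔ ∃ a : Y.X.presheaf.stalk x, algebraMap _ _ a = f := by
  rcases Y.isClosed_or_eq_genericPoint x with hc | rfl
  · have := Y.isDVR x hc
    rw [Scheme.le_ord_iff (Y.coheight_eq_one hc) hf]
    have h : Scheme.ordHom x (Y.coheight_eq_one hc) f =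
      Ring.ordFrac (Y.X.presheaf.stalk x) f := rfl
    rw [h, Ring.ordFrac_eq_valuation_inv]
    constructor
    · intro h
      apply IsDiscreteValuationRing.exists_lift_of_le_one
      rw [← inv_inv ((IsDedekindDomain.HeightOneSpectrum.valuation _ _) f)]
      exact inv_le_one_of_one_le₀ h
    · rintro ⟨a, rfl⟩
      change 1 ≤ _
      refine (one_le_inv₀ ?_).mpr (IsDedekindDomain.HeightOneSpectrum.valuation_le_one _ a)
      exact (Valuation.pos_iff _).mpr hf
  · simp only [ord_genericPoint, le_refl, true_iff]
    refine ⟨f, ?_⟩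
    change (Y.X.presheaf.stalkSpecializes _).hom f = f
    rw [TopCat.Presheaf.stalkSpecializes_refl]
    rfl

lemma ord_germ_nonneg {U : Y.X.Opens} [Nonempty U] (g : Γ(Y.X, U)) (x : Y.X) (hx : x ∈ U) :
    0 ≤ Scheme.ord (Y.X.germToFunctionField U g) x := by
  by_cases h : Y.X.germToFunctionField U g = 0
  · rw [h]; simp
  · rw [ord_nonneg_iff _ h]
    exact ⟨Y.X.presheaf.germ U x hx g, Scheme.algebraMap_germ_eq_germToFunctionField _ hx g⟩

lemma finite_support_ord {f : Y.X.functionField} (hf : f ≠ 0) :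
    (Function.support (Scheme.ord f)).Finite := by
  obtain ⟨U, -, g, hU, rfl, hg⟩ := exists_isUnit_germ_eq _ f hf
  refine (Y.finite_of_isClosed (Z := (U : Set Y.X)ᶜ) U.isOpen.isClosed_compl ?_).subset ?_
  · exact fun h => h (Y.genericPoint_mem U)
  · intro x hx hxU
    exact hx (Scheme.ord_of_isUnit hg hxU)

lemma exists_ord_eq_one {x : Y.X} (hx : IsClosed {x}) :
    ∃ f : Y.X.functionField, f ≠ 0 ∧ Scheme.ord f x = 1 := by
  have := Y.isDVR x hx
  obtain ⟨p, hp⟩ := IsDiscreteValuationRing.exists_irreducible (Y.X.presheaf.stalk x)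
  have h0 : algebraMap (Y.X.presheaf.stalk x) Y.X.functionField p ≠ 0 := by
    rw [Ne, IsFractionRing.to_map_eq_zero_iff]
    exact hp.ne_zero
  refine ⟨algebraMap _ _ p, h0, ?_⟩
  rw [Scheme.ord_eq_iff (Y.coheight_eq_one hx) h0]
  exact Ring.ordFrac_irreducible hp

/-- A function `D` on the points of the curve with finitely many nonzero values, all of them at
closed points, is locally near each point the divisor of a rational function. -/
lemma exists_local_equation {D : Y.X → ℤ} (hD : D.support.Finite) (hD0 : D (genericPoint Y.X) = 0)
    (x : Y.X) : ∃ (V : Y.X.Opens) (_ : x ∈ V) (f : Y.X.functionField), f ≠ 0 ∧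
      ∀ y ∈ V, Scheme.ord f y = D y := by
  obtain ⟨f, hf, hfx⟩ : ∃ f : Y.X.functionField, f ≠ 0 ∧ Scheme.ord f x = D x := by
    rcases Y.isClosed_or_eq_genericPoint x with hc | rfl
    · obtain ⟨p, hp, hpx⟩ := Y.exists_ord_eq_one hc
      exact ⟨p ^ D x, zpow_ne_zero _ hp, by rw [ord_zpow _ hp, hpx, mul_one]⟩
    · exact ⟨1, one_ne_zero, by rw [ord_one, hD0]⟩
  have hfin : {y | Scheme.ord f y ≠ D y}.Finite := by
    refine ((Y.finite_support_ord hf).union hD).subset fun y hy => ?_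
    by_contra h
    simp only [Set.mem_union, Function.mem_support, not_or, not_not] at h
    exact hy (h.1.trans h.2.symm)
  have hcl := Y.isClosed_of_finite hfin (by simp [ord_genericPoint, hD0])
  refine ⟨⟨_, hcl.isOpen_compl⟩, fun h => h hfx, f, hf, fun y hy => ?_⟩
  by_contra h
  exact hy h

end SmoothCurve

/-! ### Rational embeddings of line bundles -/

namespace SmoothCurve

variable {k : Type u} [Field k] (Y : SmoothCurve k)

open TopologicalSpace Opposite

section Gluing

variable {C : Type*} [Category* C] {FC : C → C → Type*} {CC : C → Type u}
  [∀ A B, FunLike (FC A B) (CC A) (CC B)] [ConcreteCategory C FC]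
  [HasLimitsOfSize.{u, u} C] [(forget C).ReflectsIsomorphisms]
  [PreservesLimitsOfSize.{u, u} (forget C)]

/-- If the sections of a sheaf over nonempty open sets embed compatibly in a fixed set, then an
element of this set that comes from sections locally comes from a section. -/
lemma exists_section_of_locally {F : TopCat.Presheaf C Y.X} (hF : F.IsSheaf) {K : Type*}
    (ρ : ∀ (U : Y.X.Opens) [Nonempty U], ToType (F.obj (op U)) → K)
    (hres : ∀ {U V : Y.X.Opens} [Nonempty U] [Nonempty V] (h : V ≤ U) (s : ToType (F.obj (op U))),
      ρ V (F.map (homOfLE h).op s) = ρ U s)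
    (hinj : ∀ (U : Y.X.Opens) [Nonempty U], Function.Injective (ρ U))
    (U : Y.X.Opens) [Nonempty U] (f : K)
    (h : ∀ x ∈ U, ∃ (V : Y.X.Opens) (_ : x ∈ V) (_ : Nonempty V) (_ : V ≤ U)
      (s : ToType (F.obj (op V))), ρ V s = f) :
    ∃ s : ToType (F.obj (op U)), ρ U s = f := by
  choose V hxV hV hVU s hs using fun x : U => h x.1 x.2
  obtain ⟨t, ht, -⟩ := TopCat.Sheaf.existsUnique_gluing' ⟨F, hF⟩ V U (fun x => homOfLE (hVU x))
    (fun x hx => Opens.mem_iSup.mpr ⟨⟨x, hx⟩, hxV ⟨x, hx⟩⟩) s (fun x y => by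
      have := hV x
      have := hV y
      apply hinj (V x ⊓ V y)
      exact ((hres inf_le_left (s x)).trans (hs x)).trans
        ((hres inf_le_right (s y)).trans (hs y)).symm)
  obtain ⟨x⟩ := ‹Nonempty U›
  refine ⟨t, ?_⟩
  have := hV x
  have : Nonempty U := ⟨x⟩
  rw [← hres (hVU x) t, ← hs x]
  exact congrArg (ρ (V x)) (ht x)

end Gluing

/-- A rational function that is regular at all points of `U` is a section of the structure sheaf
over `U`. -/
lemma exists_germ_eq (U : Y.X.Opens) [Nonempty U] {f : Y.X.functionField} (hf : f ≠ 0)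
    (h : ∀ x ∈ U, 0 ≤ Scheme.ord f x) : ∃ g : Γ(Y.X, U), Y.X.germToFunctionField U g = f := by
  refine Y.exists_section_of_locally Y.X.sheaf.2
    (fun U _ => (Y.X.germToFunctionField U).hom) ?_
    (fun U _ => Y.X.germToFunctionField_injective U) U f ?_
  · intro U V _ _ h s
    exact TopCat.Presheaf.germ_res_apply _ _ _ _ s
  · intro x hx
    obtain ⟨a, ha⟩ := (Y.ord_nonneg_iff hf x).mp (h x hx)
    obtain ⟨V, hxV, s, rfl⟩ := Y.X.presheaf.exists_germ_eq a
    have hV : Nonempty (V ⊓ U : Y.X.Opens) := ⟨⟨x, hxV, hx⟩⟩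
    refine ⟨V ⊓ U, ⟨hxV, hx⟩, hV, inf_le_right,
      Y.X.presheaf.map (homOfLE inf_le_left).op s, ?_⟩
    have : Nonempty V := ⟨⟨x, hxV⟩⟩
    rw [← ha]
    refine Eq.trans ?_ (Scheme.algebraMap_germ_eq_germToFunctionField _ hxV s).symm
    exact TopCat.Presheaf.germ_res_apply _ _ _ _ s

/-- An embedding of the `𝒪`-module `L` in the constant sheaf of rational functions, given on the
sections over nonempty open sets. For a line bundle it amounts to the choice of a nonzero rational
section of `L`. -/
structure RationalEmbedding (L : Y.X.Modules) where
  toFun : ∀ (U : Y.X.Opens) [Nonempty U], Γ(L, U) → Y.X.functionField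
  map_add : ∀ (U : Y.X.Opens) [Nonempty U] (s t : Γ(L, U)), toFun U (s + t) = toFun U s + toFun U t
  map_smul : ∀ (U : Y.X.Opens) [Nonempty U] (g : Γ(Y.X, U)) (s : Γ(L, U)),
    toFun U (g • s) = Y.X.germToFunctionField U g * toFun U s
  map_res : ∀ {U V : Y.X.Opens} [Nonempty U] [Nonempty V] (h : V ≤ U) (s : Γ(L, U)),
    toFun V (res L h s) = toFun U s
  injective : ∀ (U : Y.X.Opens) [Nonempty U], Function.Injective (toFun U)

namespace RationalEmbedding

variable {Y} {L : Y.X.Modules} (ρ : Y.RationalEmbedding L)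

lemma map_zero (U : Y.X.Opens) [Nonempty U] : ρ.toFun U 0 = 0 := by
  have := ρ.map_add U 0 0
  rw [add_zero] at this
  exact left_eq_add.mp this

lemma map_eq_zero {U : Y.X.Opens} [Nonempty U] {s : Γ(L, U)} : ρ.toFun U s = 0 ↔ s = 0 :=
  ⟨fun h => ρ.injective U (h.trans (ρ.map_zero U).symm), fun h => h ▸ ρ.map_zero U⟩

/-- The rational embedding `ρ` identifies `L` with `𝒪(-D)`: the image of the sections over `U`
consists of the rational functions with divisor at least `D` on `U`. -/
structure HasDivisor (D : Y.X → ℤ) : Prop where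
  finite : D.support.Finite
  map_genericPoint : D (genericPoint Y.X) = 0
  exists_iff : ∀ (U : Y.X.Opens) [Nonempty U] (f : Y.X.functionField), f ≠ 0 →
    ((∃ s, ρ.toFun U s = f) ↔ ∀ x ∈ U, D x ≤ Scheme.ord f x)

end RationalEmbedding

lemma subsingleton_of_isEmpty {L : Y.X.Modules} {U : Y.X.Opens} (h : ¬ Nonempty U) :
    Subsingleton Γ(L, U) := by
  refine ⟨fun s t => TopCat.Sheaf.eq_of_locally_eq' ⟨L.presheaf, L.isSheaf⟩
    (fun e : PEmpty.{1} => U) U (fun e => e.elim) ?_ s t (fun e => e.elim)⟩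
  intro x hx
  exact absurd ⟨⟨x, hx⟩⟩ h

lemma res_smul {L : Y.X.Modules} {U V : Y.X.Opens} (h : V ≤ U) (g : Γ(Y.X, U)) (s : Γ(L, U)) :
    res L h (g • s) = Y.X.presheaf.map (homOfLE h).op g • res L h s :=
  Scheme.Modules.map_smul L (homOfLE h) g s

lemma res_res {L : Y.X.Modules} {U V W : Y.X.Opens} (h : V ≤ U) (h' : W ≤ V) (s : Γ(L, U)) :
    res L h' (res L h s) = res L (h'.trans h) s := by
  unfold res
  rw [← ConcreteCategory.comp_apply, ← Functor.map_comp]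
  rfl

lemma res_zero {L : Y.X.Modules} {U V : Y.X.Opens} (h : V ≤ U) : res L h 0 = 0 :=
  _root_.map_zero (L.presheaf.map (homOfLE h).op).hom

lemma res_add {L : Y.X.Modules} {U V : Y.X.Opens} (h : V ≤ U) (s t : Γ(L, U)) :
    res L h (s + t) = res L h s + res L h t :=
  _root_.map_add (L.presheaf.map (homOfLE h).op).hom s t

variable {Y}

/-- A line bundle on an integral scheme is torsion free: a section that vanishes on a nonempty
open subset is zero. -/
lemma eq_zero_of_res_eq_zero {L : Y.X.Modules} (hL : IsLineBundle L) {U V : Y.X.Opens} [Nonempty V]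
    (h : V ≤ U) {s : Γ(L, U)} (hs : res L h s = 0) : s = 0 := by
  choose W hW e he using hL
  refine TopCat.Sheaf.eq_of_locally_eq' ⟨L.presheaf, L.isSheaf⟩ (fun x : U => U ⊓ W x.1) U
    (fun x => homOfLE inf_le_left) (fun x hx => Opens.mem_iSup.mpr ⟨⟨x, hx⟩, hx, hW x⟩) s 0 ?_
  rintro ⟨x, hx⟩
  have : Nonempty (W x) := ⟨⟨x, hW x⟩⟩
  have : Nonempty U := ⟨⟨x, hx⟩⟩
  change res L inf_le_left s = res L inf_le_left 0
  rw [res_zero]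
  obtain ⟨g, hg⟩ := (he x (U ⊓ W x) inf_le_right).2 (res L inf_le_left s)
  dsimp only at hg
  suffices g = 0 by rw [← hg, this, zero_smul]
  apply map_injective_of_isIntegral Y.X (homOfLE (show V ⊓ W x ≤ U ⊓ W x from inf_le_inf_right _ h))
  rw [_root_.map_zero]
  apply (he x (V ⊓ W x) inf_le_right).1
  dsimp only
  rw [zero_smul, ← res_res Y inf_le_right (inf_le_inf_right _ h), ← res_smul, hg, res_res,
    ← res_res Y h inf_le_left, hs, res_zero]

lemma germ_res {U V : Y.X.Opens} [Nonempty U] [Nonempty V] (h : V ≤ U) (g : Γ(Y.X, U)) :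
    Y.X.germToFunctionField V (Y.X.presheaf.map (homOfLE h).op g) =
      Y.X.germToFunctionField U g :=
  TopCat.Presheaf.germ_res_apply _ _ _ _ g

/-- A line bundle embeds in the constant sheaf of rational functions, by the coordinate with respect
to a generator over a nonempty open set. -/
lemma exists_rationalEmbedding {L : Y.X.Modules} (hL : IsLineBundle L) {U₀ : Y.X.Opens}
    [Nonempty U₀] {e₀ : Γ(L, U₀)} (he₀ : IsGenerator L e₀) :
    ∃ ρ : Y.RationalEmbedding L, ρ.toFun U₀ e₀ = 1 := by
  choose g hg using fun (U : Y.X.Opens) (s : Γ(L, U)) =>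
    (he₀ (U ⊓ U₀) inf_le_right).2 (res L inf_le_left s)
  dsimp only at hg
  have key : ∀ (U V : Y.X.Opens) [Nonempty U] [Nonempty V] (h : V ≤ U) (hV : V ≤ U₀)
      (s : Γ(L, U)) (f : Γ(Y.X, V)), f • res L hV e₀ = res L h s →
        Y.X.germToFunctionField (U ⊓ U₀) (g U s) = Y.X.germToFunctionField V f := by
    intro U V _ _ h hV s f hf
    rw [← germ_res (le_inf h hV)]
    congr 1
    apply (he₀ V hV).1
    dsimp only
    rw [hf, ← res_res Y inf_le_right (le_inf h hV), ← res_smul, hg, res_res]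
  refine ⟨⟨fun U _ s => Y.X.germToFunctionField (U ⊓ U₀) (g U s), ?_, ?_, ?_, ?_⟩, ?_⟩
  · intro U _ s t
    rw [← _root_.map_add]
    refine key U (U ⊓ U₀) inf_le_left inf_le_right _ _ ?_
    rw [add_smul, hg, hg, res_add]
  · intro U _ a s
    rw [← germ_res (inf_le_left : U ⊓ U₀ ≤ U) a, ← _root_.map_mul]
    refine key U (U ⊓ U₀) inf_le_left inf_le_right _ _ ?_
    rw [mul_smul, hg, res_smul]
  · intro U V _ _ h s
    symm
    refine key U (V ⊓ U₀) (inf_le_left.trans h) inf_le_right _ _ ?_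
    rw [hg, res_res]
  · intro U _ s t hst
    have h := Y.X.germToFunctionField_injective _ hst
    have h2 : res L (inf_le_left : U ⊓ U₀ ≤ U) (s - t) = 0 := by
      rw [sub_eq_add_neg, res_add, ← neg_one_smul (Γ(Y.X, U)) t, res_smul, _root_.map_neg,
        _root_.map_one, neg_one_smul, ← hg, ← hg, h, add_neg_cancel]
    exact sub_eq_zero.mp (eq_zero_of_res_eq_zero hL _ h2)
  · dsimp only
    rw [← _root_.map_one (Y.X.germToFunctionField U₀).hom]
    exact key U₀ U₀ le_rfl le_rfl _ _ (by rw [one_smul])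

namespace RationalEmbedding

variable {L : Y.X.Modules} (ρ : Y.RationalEmbedding L)

lemma ne_zero_of_isGenerator {U : Y.X.Opens} [Nonempty U] {e : Γ(L, U)} (he : IsGenerator L e) :
    ρ.toFun U e ≠ 0 := by
  intro h
  rw [ρ.map_eq_zero] at h
  have := (he U le_rfl).1 (a₁ := 0) (a₂ := 1) (by simp [h, res_zero])
  exact zero_ne_one this

/-- With respect to a generator `e` over an open set, the sections have the regular functions as
coordinates. -/
lemma ord_generator_le {U V : Y.X.Opens} [Nonempty U] [Nonempty V] {e : Γ(L, U)}
    (he : IsGenerator L e) {s : Γ(L, V)} (hs : s ≠ 0) {x : Y.X} (hU : x ∈ U) (hV : x ∈ V) :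
    Scheme.ord (ρ.toFun U e) x ≤ Scheme.ord (ρ.toFun V s) x := by
  obtain ⟨g, hg⟩ := (he (U ⊓ V) inf_le_left).2 (res L inf_le_right s)
  dsimp only at hg
  have h := congrArg (ρ.toFun (U ⊓ V)) hg
  rw [ρ.map_smul, ρ.map_res, ρ.map_res] at h
  have hs' := mt ρ.map_eq_zero.mp hs
  have hg0 : Y.X.germToFunctionField (U ⊓ V) g ≠ 0 := by
    rintro h0
    rw [h0, zero_mul] at h
    exact hs' h.symm
  rw [← h, Scheme.ord_mul hg0 (ρ.ne_zero_of_isGenerator he)]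
  have := Y.ord_germ_nonneg g x ⟨hU, hV⟩
  omega

lemma ord_generator_eq {U V : Y.X.Opens} [Nonempty U] [Nonempty V] {e : Γ(L, U)}
    (he : IsGenerator L e) {e' : Γ(L, V)} (he' : IsGenerator L e') {x : Y.X} (hU : x ∈ U)
    (hV : x ∈ V) : Scheme.ord (ρ.toFun U e) x = Scheme.ord (ρ.toFun V e') x := by
  refine le_antisymm (ρ.ord_generator_le he ?_ hU hV) (ρ.ord_generator_le he' ?_ hV hU)
  · exact mt ρ.map_eq_zero.mpr (ρ.ne_zero_of_isGenerator he')
  · exact mt ρ.map_eq_zero.mpr (ρ.ne_zero_of_isGenerator he)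

lemma exists_section_of_locally (U : Y.X.Opens) [Nonempty U] (f : Y.X.functionField)
    (h : ∀ x ∈ U, ∃ (V : Y.X.Opens) (_ : x ∈ V) (_ : Nonempty V) (_ : V ≤ U)
      (s : Γ(L, V)), ρ.toFun V s = f) : ∃ s : Γ(L, U), ρ.toFun U s = f :=
  Y.exists_section_of_locally L.isSheaf (fun U _ => ρ.toFun U) (fun h s => ρ.map_res h s)
    ρ.injective U f h

/-- Every rational embedding of a line bundle has a divisor, the orders of the local generators. -/
lemma exists_hasDivisor (hL : IsLineBundle L) : ∃ D, ρ.HasDivisor D := by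
  have hL' := hL
  choose W hW e he using hL
  have hWn : ∀ x, Nonempty (W x) := fun x => ⟨⟨x, hW x⟩⟩
  let D : Y.X → ℤ := fun x => Scheme.ord (ρ.toFun (W x) (e x)) x
  refine ⟨D, ?_, Y.ord_genericPoint _, ?_⟩
  · let η := genericPoint Y.X
    have h1 := Y.finite_support_ord (ρ.ne_zero_of_isGenerator (he η))
    have h2 := Y.finite_of_isClosed (Z := (W η : Set Y.X)ᶜ) (W η).isOpen.isClosed_compl
      (fun h => h (hW η))
    refine (h1.union h2).subset fun x hx => ?_
    by_contra h
    simp only [Set.mem_union, Set.mem_compl_iff, not_or, not_not, Function.mem_support] at h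
    exact hx ((ρ.ord_generator_eq (he x) (he η) (hW x) h.2).trans h.1)
  · intro U _ f hf
    constructor
    · rintro ⟨s, rfl⟩ x hx
      exact ρ.ord_generator_le (he x) (mt ρ.map_eq_zero.mpr hf) (hW x) hx
    · intro h
      refine ρ.exists_section_of_locally U f fun x hx => ?_
      have h0 := ρ.ne_zero_of_isGenerator (he x)
      have hd : f / ρ.toFun (W x) (e x) ≠ 0 := div_ne_zero hf h0
      obtain ⟨a, ha⟩ := (Y.ord_nonneg_iff hd x).mp (by
        rw [Y.ord_div hf h0]
        exact sub_nonneg.mpr (h x hx))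
      obtain ⟨V, hxV, g, rfl⟩ := Y.X.presheaf.exists_germ_eq a
      have : Nonempty V := ⟨⟨x, hxV⟩⟩
      rw [Scheme.algebraMap_germ_eq_germToFunctionField _ hxV g] at ha
      have hV : V ⊓ W x ⊓ U ≤ V := inf_le_left.trans inf_le_left
      have hVW : V ⊓ W x ⊓ U ≤ W x := inf_le_left.trans inf_le_right
      refine ⟨V ⊓ W x ⊓ U, ⟨⟨hxV, hW x⟩, hx⟩, inferInstance, inf_le_right,
        Y.X.presheaf.map (homOfLE hV).op g • res L hVW (e x), ?_⟩
      rw [ρ.map_smul, ρ.map_res, germ_res, ha, div_mul_cancel₀ _ h0]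

namespace HasDivisor

variable {ρ} {D : Y.X → ℤ} (hD : ρ.HasDivisor D)
include hD

lemma le_ord {U : Y.X.Opens} [Nonempty U] {s : Γ(L, U)} (hs : s ≠ 0) {x : Y.X} (hx : x ∈ U) :
    D x ≤ Scheme.ord (ρ.toFun U s) x :=
  (hD.exists_iff U _ (mt ρ.map_eq_zero.mp hs)).mp ⟨s, rfl⟩ x hx

lemma exists_generator (x : Y.X) : ∃ (U : Y.X.Opens) (_ : x ∈ U) (_ : Nonempty U) (e : Γ(L, U)),
    IsGenerator L e ∧ Scheme.ord (ρ.toFun U e) x = D x := by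
  obtain ⟨V, hxV, f, hf, hfD⟩ := Y.exists_local_equation hD.finite hD.map_genericPoint x
  have : Nonempty V := ⟨⟨x, hxV⟩⟩
  obtain ⟨e, he⟩ := (hD.exists_iff V f hf).mpr fun y hy => (hfD y hy).ge
  refine ⟨V, hxV, this, e, ?_, he ▸ hfD x hxV⟩
  intro W hW
  by_cases hWn : Nonempty W
  · constructor
    · intro a b hab
      have h := congrArg (ρ.toFun W) hab
      dsimp only at h
      rw [ρ.map_smul, ρ.map_smul, ρ.map_res, he] at h
      exact Y.X.germToFunctionField_injective W (mul_right_cancel₀ hf h)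
    · intro s
      by_cases hs : s = 0
      · exact ⟨0, by simp [hs]⟩
      have hs' := mt ρ.map_eq_zero.mp hs
      obtain ⟨g, hg⟩ := Y.exists_germ_eq W (div_ne_zero hs' hf) fun y hy => by
        rw [Y.ord_div hs' hf, hfD y (hW hy)]
        exact sub_nonneg.mpr (hD.le_ord hs hy)
      refine ⟨g, ρ.injective W ?_⟩
      dsimp only
      rw [ρ.map_smul, ρ.map_res, he, hg, div_mul_cancel₀ _ hf]
  · have hbot : W = ⊥ := by
      ext y
      exact ⟨fun hy => absurd ⟨⟨y, hy⟩⟩ hWn, fun hy => hy.elim⟩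
    have h1 := Y.subsingleton_of_isEmpty (L := L) hWn
    have h2 : Subsingleton Γ(Y.X, W) := by
      subst hbot
      infer_instance
    exact ⟨fun a b _ => Subsingleton.elim _ _, fun s => ⟨0, Subsingleton.elim _ _⟩⟩

lemma isLineBundle : IsLineBundle L := fun x => by
  obtain ⟨U, hx, -, e, he, -⟩ := hD.exists_generator x
  exact ⟨U, hx, e, he⟩

lemma ord_generator {U : Y.X.Opens} [Nonempty U] {e : Γ(L, U)} (he : IsGenerator L e) {x : Y.X}
    (hx : x ∈ U) : Scheme.ord (ρ.toFun U e) x = D x := by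
  obtain ⟨V, hxV, _, e', he', h⟩ := hD.exists_generator x
  rw [← h]
  exact ρ.ord_generator_eq he he' hx hxV

lemma unique {D' : Y.X → ℤ} (hD' : ρ.HasDivisor D') : D = D' := by
  ext x
  obtain ⟨V, hxV, _, e, he, h⟩ := hD.exists_generator x
  rw [← h, hD'.ord_generator he hxV]

lemma hasOrd_iff {U : Y.X.Opens} [Nonempty U] {s : Γ(L, U)} (hs : s ≠ 0) (x : Y.X) (n : ℤ) :
    HasOrd L s x n ↔ n = Scheme.ord (ρ.toFun U s) x - D x := by
  constructor
  · rintro ⟨V, hx, e, he, W, _, hU, hV, g, h, rfl⟩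
    have : Nonempty V := ⟨⟨x, hx⟩⟩
    have h := congrArg (ρ.toFun W) h
    rw [ρ.map_smul, ρ.map_res, ρ.map_res] at h
    have hs' := mt ρ.map_eq_zero.mp hs
    have hg0 : Y.X.germToFunctionField W g ≠ 0 := fun h0 => by
      rw [h0, zero_mul] at h
      exact hs' h
    rw [h, Scheme.ord_mul hg0 (ρ.ne_zero_of_isGenerator he), hD.ord_generator he hx]
    ring
  · rintro rfl
    obtain ⟨V, hx, _, e, he, h⟩ := hD.exists_generator x
    obtain ⟨g, hg⟩ := (he (U ⊓ V) inf_le_right).2 (res L inf_le_left s)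
    dsimp only at hg
    refine ⟨V, hx, e, he, U ⊓ V, inferInstance, inf_le_left, inf_le_right, g, hg.symm, ?_⟩
    have h' := congrArg (ρ.toFun (U ⊓ V)) hg
    rw [ρ.map_smul, ρ.map_res, ρ.map_res] at h'
    have hs' := mt ρ.map_eq_zero.mp hs
    have hg0 : Y.X.germToFunctionField (U ⊓ V) g ≠ 0 := fun h0 => by
      rw [h0, zero_mul] at h'
      exact hs' h'.symm
    rw [← h', Scheme.ord_mul hg0 (ρ.ne_zero_of_isGenerator he), h]
    ring

/-- The order of vanishing in terms of a rational embedding. -/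
lemma ordAt_eq {U : Y.X.Opens} [Nonempty U] {s : Γ(L, U)} (hs : s ≠ 0) (x : Y.X) :
    ordAt L s x = Scheme.ord (ρ.toFun U s) x - D x :=
  (hD.hasOrd_iff hs x _).mp (Classical.epsilon_spec (p := fun n => HasOrd L s x n)
    ⟨_, (hD.hasOrd_iff hs x _).mpr rfl⟩)

end HasDivisor

end RationalEmbedding

/-! ### Morphisms -/

section Hom

variable {L L' : Y.X.Modules}

lemma app_res (φ : L' ⟶ L) {U V : Y.X.Opens} (h : V ≤ U) (s : Γ(L', U)) :
    φ.app V (res L' h s) = res L h (φ.app U s) :=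
  ConcreteCategory.congr_hom (φ.mapPresheaf.naturality (homOfLE h).op) s

/-- A morphism of `𝒪`-modules from its values on sections. -/
lemma exists_hom (f : ∀ U : Y.X.Opens, Γ(L', U) → Γ(L, U))
    (hadd : ∀ U s t, f U (s + t) = f U s + f U t)
    (hsmul : ∀ (U : Y.X.Opens) (g : Γ(Y.X, U)) s, f U (g • s) = g • f U s)
    (hres : ∀ {U V : Y.X.Opens} (h : V ≤ U) s, f V (res L' h s) = res L h (f U s)) :
    ∃ φ : L' ⟶ L, ∀ U s, φ.app U s = f U s := by
  let α : L'.presheaf ⟶ L.presheaf :=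
    { app := fun U => AddCommGrpCat.ofHom (AddMonoidHom.mk' (f U.unop) (hadd U.unop))
      naturality := fun U V i => by
        ext s
        exact hres (leOfHom i.unop) s }
  let β : L'.val ⟶ L.val := PresheafOfModules.homMk α fun U r m => hsmul U.unop r m
  exact ⟨SheafOfModules.Hom.mk β, fun U s => rfl⟩

namespace RationalEmbedding

/-- A line bundle whose sections, as rational functions, are sections of another one, maps to the
latter. -/
lemma exists_hom_of_le (ρ : Y.RationalEmbedding L) (ρ' : Y.RationalEmbedding L')
    (h : ∀ (U : Y.X.Opens) [Nonempty U] (s' : Γ(L', U)), ∃ s, ρ.toFun U s = ρ'.toFun U s') :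
    ∃ φ : L' ⟶ L, ∀ (U : Y.X.Opens) [Nonempty U] (s' : Γ(L', U)),
      ρ.toFun U (φ.app U s') = ρ'.toFun U s' := by
  classical
  let f : ∀ U : Y.X.Opens, Γ(L', U) → Γ(L, U) := fun U s =>
    if hU : Nonempty U then (h U s).choose else 0
  have hf : ∀ (U : Y.X.Opens) [hU : Nonempty U] (s' : Γ(L', U)),
      ρ.toFun U (f U s') = ρ'.toFun U s' := fun U hU s' => by
    simp only [f, dif_pos hU]
    exact (h U s').choose_spec
  have aux : ∀ (U : Y.X.Opens) (s t : Γ(L, U)),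
      (∀ [Nonempty U], ρ.toFun U s = ρ.toFun U t) → s = t := fun U s t hst => by
    by_cases hU : Nonempty U
    · exact ρ.injective U hst
    · have := Y.subsingleton_of_isEmpty (L := L) hU
      exact Subsingleton.elim _ _
  obtain ⟨φ, hφ⟩ := exists_hom f
    (fun U s t => aux U _ _ (by intro; rw [ρ.map_add, hf, hf, hf, ρ'.map_add]))
    (fun U g s => aux U _ _ (by intro; rw [ρ.map_smul, hf, hf, ρ'.map_smul]))
    (fun {U V} hVU s => aux V _ _ (by
      intro hV
      have : Nonempty U := hV.map fun x => ⟨x.1, hVU x.2⟩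
      rw [hf, ρ.map_res, ρ'.map_res, hf]))
  exact ⟨φ, fun U _ s' => by rw [hφ, hf]⟩

lemma hom_ext_of_eq (ρ : Y.RationalEmbedding L) {φ ψ : L' ⟶ L}
    (h : ∀ (U : Y.X.Opens) [Nonempty U] (s : Γ(L', U)),
      ρ.toFun U (φ.app U s) = ρ.toFun U (ψ.app U s)) : φ = ψ := by
  refine Scheme.Modules.hom_ext _ _ fun U => ?_
  ext s
  by_cases hU : Nonempty U
  · exact ρ.injective U (h U s)
  · have := Y.subsingleton_of_isEmpty (L := L) hU
    exact Subsingleton.elim (α := Γ(L, U)) _ _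

/-- Line bundles with rational embeddings that have the same divisor are isomorphic. -/
lemma exists_iso {ρ : Y.RationalEmbedding L} {ρ' : Y.RationalEmbedding L'} {D : Y.X → ℤ}
    (hD : ρ.HasDivisor D) (hD' : ρ'.HasDivisor D) :
    ∃ ψ : L' ≅ L, ∀ (U : Y.X.Opens) [Nonempty U] (s' : Γ(L', U)),
      ρ.toFun U (ψ.hom.app U s') = ρ'.toFun U s' := by
  obtain ⟨φ, hφ⟩ := exists_hom_of_le ρ ρ' fun U _ s' => by
    by_cases hs : s' = 0
    · exact ⟨0, by rw [ρ.map_zero, hs, ρ'.map_zero]⟩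
    · exact (hD.exists_iff U _ (mt ρ'.map_eq_zero.mp hs)).mpr fun x hx => hD'.le_ord hs hx
  obtain ⟨ψ, hψ⟩ := exists_hom_of_le ρ' ρ fun U _ s' => by
    by_cases hs : s' = 0
    · exact ⟨0, by rw [ρ'.map_zero, hs, ρ.map_zero]⟩
    · exact (hD'.exists_iff U _ (mt ρ.map_eq_zero.mp hs)).mpr fun x hx => hD.le_ord hs hx
  refine ⟨⟨φ, ψ, ρ'.hom_ext_of_eq fun U _ s => ?_, ρ.hom_ext_of_eq fun U _ s => ?_⟩, hφ⟩
  · change ρ'.toFun U (ψ.app U (φ.app U s)) = ρ'.toFun U s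
    rw [hψ, hφ]
  · change ρ.toFun U (φ.app U (ψ.app U s)) = ρ.toFun U s
    rw [hφ, hψ]

/-- The rational embedding of a submodule. -/
def comp (ρ : Y.RationalEmbedding L) (φ : L' ⟶ L)
    (hφ : ∀ U : Y.X.Opens, Function.Injective (φ.app U)) : Y.RationalEmbedding L' where
  toFun U _ s := ρ.toFun U (φ.app U s)
  map_add U _ s t := by rw [_root_.map_add, ρ.map_add]
  map_smul U _ g s := by rw [Scheme.Modules.Hom.app_smul, ρ.map_smul]
  map_res h s := by rw [app_res, ρ.map_res]
  injective U _ := (ρ.injective U).comp (hφ U)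

/-- The rational embedding multiplied by a nonzero rational function. -/
def scale (ρ : Y.RationalEmbedding L) {c : Y.X.functionField} (hc : c ≠ 0) :
    Y.RationalEmbedding L where
  toFun U _ s := c * ρ.toFun U s
  map_add U _ s t := by rw [ρ.map_add, mul_add]
  map_smul U _ g s := by rw [ρ.map_smul, mul_left_comm]
  map_res h s := by rw [ρ.map_res]
  injective U _ := (mul_right_injective₀ hc).comp (ρ.injective U)

/-- Two rational embeddings of a line bundle differ by a rational function. -/
lemma exists_eq_mul (hL : IsLineBundle L) (ρ ρ' : Y.RationalEmbedding L) :
    ∃ c : Y.X.functionField, c ≠ 0 ∧ ∀ (U : Y.X.Opens) [Nonempty U] (s : Γ(L, U)),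
      ρ'.toFun U s = c * ρ.toFun U s := by
  obtain ⟨W, hW, e, he⟩ := hL (genericPoint Y.X)
  have : Nonempty W := ⟨⟨_, hW⟩⟩
  have h0 := ρ.ne_zero_of_isGenerator he
  refine ⟨ρ'.toFun W e / ρ.toFun W e, div_ne_zero (ρ'.ne_zero_of_isGenerator he) h0, ?_⟩
  intro U _ s
  obtain ⟨g, hg⟩ := (he (U ⊓ W) inf_le_right).2 (res L inf_le_left s)
  dsimp only at hg
  have h1 := congrArg (ρ.toFun (U ⊓ W)) hg
  have h2 := congrArg (ρ'.toFun (U ⊓ W)) hg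
  rw [map_smul, map_res, map_res] at h1 h2
  rw [← h1, ← h2]
  field_simp

end RationalEmbedding

end Hom

/-! ### The line bundle of a divisor -/

section OfDivisor

variable (D : Y.X → ℤ)

/-- The sections over `U` of the line bundle `𝒪(-D)`: rational functions, as constant functions on
`U` (so that there is only one over the empty set), with divisor at least `D` on `U`. -/
def divisorPredicate : TopCat.LocalPredicate (X := Y.X.toTopCat) (fun _ => Y.X.functionField) where
  pred {_} f := (∀ x y, f x = f y) ∧ ∀ x, f x ≠ 0 → D x.1 ≤ Scheme.ord (f x) x.1
  res i f h := ⟨fun x y => h.1 (i x) (i y), fun x => h.2 (i x)⟩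
  locality {U} f h := by
    choose V hV i hi using h
    refine ⟨fun x y => ?_, fun x => (hi x).2 ⟨x.1, hV x⟩⟩
    have hx : Nonempty (V x : Y.X.Opens) := ⟨⟨x.1, hV x⟩⟩
    have hy : Nonempty (V y : Y.X.Opens) := ⟨⟨y.1, hV y⟩⟩
    have h1 := (hi x).1 ⟨x.1, hV x⟩ ⟨_, Y.genericPoint_mem (V x) (h := hx)⟩
    have h2 := (hi y).1 ⟨y.1, hV y⟩ ⟨_, Y.genericPoint_mem (V y) (h := hy)⟩
    exact h1.trans h2.symm

/-- The regular functions on `U` as functions with values in the function field. -/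
def regularFunctions (U : Y.X.Opens) : Γ(Y.X, U) →+* (U → Y.X.functionField) :=
  RingHom.pi fun x => (algebraMap (Y.X.presheaf.stalk x.1) Y.X.functionField).comp
    (Y.X.presheaf.germ U x.1 x.2).hom

lemma regularFunctions_apply (U : Y.X.Opens) [Nonempty U] (g : Γ(Y.X, U)) (x : U) :
    regularFunctions U g x = Y.X.germToFunctionField U g :=
  Scheme.algebraMap_germ_eq_germToFunctionField _ x.2 g

lemma regularFunctions_res {U V : Y.X.Opens} (h : V ≤ U) (a : Γ(Y.X, U)) (x : V) :
    regularFunctions V (Y.X.presheaf.map (homOfLE h).op a) x =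
      regularFunctions U a ⟨x.1, h x.2⟩ := by
  have hV : Nonempty V := ⟨x⟩
  have hU : Nonempty U := ⟨⟨x.1, h x.2⟩⟩
  rw [regularFunctions_apply, regularFunctions_apply, germ_res]

/-- The sections of `𝒪(-D)` over `U`. -/
def divisorSections (U : Y.X.Opens) : AddSubgroup (U → Y.X.functionField) where
  carrier := {f | (divisorPredicate D).pred f}
  zero_mem' := ⟨fun _ _ => rfl, fun _ h => absurd rfl h⟩
  add_mem' {f g} hf hg := by
    refine ⟨fun x y => congrArg₂ (· + ·) (hf.1 x y) (hg.1 x y), fun x h => ?_⟩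
    change f x + g x ≠ 0 at h
    change _ ≤ Scheme.ord (f x + g x) x.1
    by_cases h1 : f x = 0
    · rw [h1, zero_add] at h ⊢
      exact hg.2 x h
    · by_cases h2 : g x = 0
      · rw [h2, add_zero]
        exact hf.2 x h1
      · exact (le_min (hf.2 x h1) (hg.2 x h2)).trans (Y.min_le_ord_add h x.1)
  neg_mem' {f} hf := by
    refine ⟨fun x y => congrArg Neg.neg (hf.1 x y), fun x h => ?_⟩
    change _ ≤ Scheme.ord (-f x) x.1
    rw [Y.ord_neg]
    exact hf.2 x (neg_ne_zero.mp h)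

lemma regularFunctions_mul_mem {U : Y.X.Opens} (a : Γ(Y.X, U)) {f : U → Y.X.functionField}
    (hf : f ∈ divisorSections D U) : regularFunctions U a * f ∈ divisorSections D U := by
  refine ⟨fun x y => ?_, fun x h => ?_⟩
  · have : Nonempty U := ⟨x⟩
    rw [Pi.mul_apply, Pi.mul_apply, regularFunctions_apply, regularFunctions_apply, hf.1 x y]
  · have : Nonempty U := ⟨x⟩
    rw [Pi.mul_apply, regularFunctions_apply] at h ⊢
    rw [Scheme.ord_mul (left_ne_zero_of_mul h) (right_ne_zero_of_mul h)]
    have h1 := Y.ord_germ_nonneg a x.1 x.2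
    have h2 := hf.2 x (right_ne_zero_of_mul h)
    omega

instance (U : Y.X.Opens) : Module Γ(Y.X, U) (divisorSections D U) where
  smul a f := ⟨regularFunctions U a * f.1, regularFunctions_mul_mem D a f.2⟩
  one_smul f := Subtype.ext (by
    change regularFunctions U 1 * f.1 = f.1
    rw [_root_.map_one, one_mul])
  mul_smul a b f := Subtype.ext (by
    change regularFunctions U (a * b) * f.1 = regularFunctions U a * (regularFunctions U b * f.1)
    rw [_root_.map_mul, mul_assoc])
  smul_zero a := Subtype.ext (mul_zero (regularFunctions U a))
  smul_add a f g := Subtype.ext (mul_add (regularFunctions U a) f.1 g.1)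
  add_smul a b f := Subtype.ext (by
    change regularFunctions U (a + b) * f.1 =
      regularFunctions U a * f.1 + regularFunctions U b * f.1
    rw [_root_.map_add, add_mul])
  zero_smul f := Subtype.ext (by
    change regularFunctions U 0 * f.1 = 0
    rw [_root_.map_zero, zero_mul])

/-- The presheaf of abelian groups underlying `𝒪(-D)`. -/
def divisorPresheaf : TopCat.Presheaf AddCommGrpCat.{u} Y.X where
  obj U := AddCommGrpCat.of (divisorSections D U.unop)
  map i := AddCommGrpCat.ofHom (AddMonoidHom.mk'
    (fun f => ⟨fun x => f.1 (i.unop x), (divisorPredicate D).res i.unop f.1 f.2⟩) fun _ _ => rfl)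

lemma isSheaf_divisorPresheaf : (divisorPresheaf D).IsSheaf := by
  rw [TopCat.Presheaf.isSheaf_iff_isSheaf_comp (forget AddCommGrpCat.{u})]
  exact TopCat.Presheaf.isSheaf_of_iso
    (show TopCat.subpresheafToTypes (divisorPredicate D).toPrelocalPredicate ≅
      divisorPresheaf D ⋙ forget AddCommGrpCat.{u} from NatIso.ofComponents fun _ => Iso.refl _)
    (TopCat.subpresheafToTypes.isSheaf (divisorPredicate D))

instance (U : Y.X.Opensᵒᵖ) : Module (Y.X.ringCatSheaf.obj.obj U) ((divisorPresheaf D).obj U) :=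
  inferInstanceAs (Module Γ(Y.X, U.unop) (divisorSections D U.unop))

/-- The `𝒪`-module `𝒪(-D)`. -/
def ofDivisor : Y.X.Modules :=
  SheafOfModules.mk (PresheafOfModules.ofPresheaf (divisorPresheaf D) fun U V i a f => by
    apply Subtype.ext
    funext x
    exact congrArg (· * f.1 (i.unop x)) (regularFunctions_res (leOfHom i.unop) a x).symm)
    (isSheaf_divisorPresheaf D)

/-- Every divisor is the divisor of a rational embedding of some line bundle. -/
lemma exists_hasDivisor_of_finite {D : Y.X → ℤ} (hD : D.support.Finite)
    (hD0 : D (genericPoint Y.X) = 0) :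
    ∃ (L : Y.X.Modules) (ρ : Y.RationalEmbedding L), ρ.HasDivisor D := by
  let ρ : Y.RationalEmbedding (ofDivisor D) :=
    { toFun := fun U _ f => (show divisorSections D U from f).1 (Classical.arbitrary U)
      map_add := fun U _ f g => rfl
      map_smul := fun U _ a f => by
        refine Eq.trans ?_ (congrArg (· * _) (regularFunctions_apply U a (Classical.arbitrary U)))
        rfl
      map_res := fun {U V} _ _ h f =>
        (show divisorSections D U from f).2.1
          ⟨(Classical.arbitrary V).1, h (Classical.arbitrary V).2⟩ _
      injective := fun U _ f g h => by
        refine Subtype.ext (funext fun x => ?_)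
        exact ((show divisorSections D U from f).2.1 _ _).trans
          (h.trans ((show divisorSections D U from g).2.1 _ _)) }
  refine ⟨ofDivisor D, ρ, hD, hD0, fun U _ f hf => ⟨?_, fun h => ?_⟩⟩
  · rintro ⟨s, rfl⟩ x hx
    have h : (show divisorSections D U from s).1 ⟨x, hx⟩ = ρ.toFun U s :=
      (show divisorSections D U from s).2.1 _ _
    rw [← h] at hf ⊢
    exact (show divisorSections D U from s).2.2 ⟨x, hx⟩ hf
  · exact ⟨(⟨fun _ => f, fun _ _ => rfl, fun x _ => h x.1 x.2⟩ : divisorSections D U), rfl⟩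

end OfDivisor

end SmoothCurve

/-! ### The orders of vanishing of a space of sections -/

/-- The number of values of a valuation with residue field `k` on a `k`-vector space is the
dimension. -/
lemma ncard_values_eq_finrank {k E : Type*} [Field k] [AddCommGroup E] [Module k E]
    [FiniteDimensional k E] (v : E → ℤ)
    (hadd : ∀ s t, s ≠ 0 → t ≠ 0 → s + t ≠ 0 → min (v s) (v t) ≤ v (s + t))
    (hsmul : ∀ (c : k) s, c ≠ 0 → s ≠ 0 → v (c • s) = v s)
    (hres : ∀ s t, s ≠ 0 → t ≠ 0 → v s = v t →
      ∃ c : k, s - c • t ≠ 0 → v t < v (s - c • t)) :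
    {n | ∃ s, s ≠ 0 ∧ v s = n}.ncard = Module.finrank k E ∧ {n | ∃ s, s ≠ 0 ∧ v s = n}.Finite := by
  classical
  set S := {n | ∃ s, s ≠ 0 ∧ v s = n} with hS
  choose b hb0 hbv using fun n : S => n.2
  -- A linear combination has the least of the orders that occur in it.
  have key : ∀ (t : Finset S) (c : S → k), (∀ n ∈ t, c n ≠ 0) → ∀ m, (∀ n ∈ t, m ≤ n) → m ∈ t →
      (∑ n ∈ t, c n • b n) ≠ 0 ∧ v (∑ n ∈ t, c n • b n) = (m : ℤ) := by
    intro t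
    induction t using Finset.induction_on_max with
    | empty => intro c _ m _ hm; simp at hm
    | insert a t hat ih =>
      intro c hc m hm hmem
      have ha : a ∉ t := fun h => lt_irrefl _ (hat a h)
      have hca := hc a (Finset.mem_insert_self _ _)
      rw [Finset.sum_insert ha]
      have hva : v (c a • b a) = a := by rw [hsmul _ _ hca (hb0 a), hbv]
      have h0a : c a • b a ≠ 0 := smul_ne_zero hca (hb0 a)
      rcases Finset.mem_insert.mp hmem with rfl | hmt
      · have : t = ∅ := by
          by_contra h
          obtain ⟨x, hx⟩ := Finset.nonempty_iff_ne_empty.mpr h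
          exact absurd (hm x (Finset.mem_insert_of_mem hx)) (not_le.mpr (hat x hx))
        subst this
        simpa using ⟨⟨hca, hb0 m⟩, hva⟩
      · obtain ⟨h1, h2⟩ := ih c (fun n hn => hc n (Finset.mem_insert_of_mem hn)) m
          (fun n hn => hm n (Finset.mem_insert_of_mem hn)) hmt
        have hlt : (m : ℤ) < a := hat m hmt
        set y := ∑ n ∈ t, c n • b n with hy
        have hneg : ∀ s : E, s ≠ 0 → v (-s) = v s := fun s hs => by
          rw [← neg_one_smul k s, hsmul _ _ (neg_ne_zero.mpr one_ne_zero) hs]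
        have hne : c a • b a + y ≠ 0 := fun h => by
          have h3 : y = -(c a • b a) := (neg_eq_of_add_eq_zero_right h).symm
          rw [h3, hneg _ h0a] at h2
          omega
        refine ⟨hne, le_antisymm ?_ ?_⟩
        · have h4 := hadd (c a • b a + y) (-(c a • b a)) hne (neg_ne_zero.mpr h0a)
            (by rwa [add_neg_cancel_comm])
          rw [add_neg_cancel_comm, hneg _ h0a, hva, h2] at h4
          omega
        · have h4 := hadd _ _ h0a h1 hne
          rw [hva, h2] at h4
          omega
  have hli : LinearIndependent k b := by
    rw [linearIndependent_iff']
    intro t c hc n hn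
    by_contra hcn
    set t' := t.filter fun n => c n ≠ 0
    have ht' : t'.Nonempty := ⟨n, by simp [t', hn, hcn]⟩
    have := key t' c (fun n hn => (Finset.mem_filter.mp hn).2) (t'.min' ht')
      (fun n hn => Finset.min'_le _ _ hn) (Finset.min'_mem _ _)
    apply this.1
    refine Eq.trans (Finset.sum_filter_of_ne fun n _ h => ?_) hc
    exact fun h0 => h (by rw [h0, zero_smul])
  have hfin : Finite S := hli.finite
  have hfinS : S.Finite := hfin
  -- A vector outside the span of the chosen ones with the greatest possible order could be changed
  -- by a multiple of a chosen one so as to have a greater order.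
  have hspan : ⊤ ≤ Submodule.span k (Set.range b) := by
    intro s _
    by_contra hs
    obtain ⟨n, ⟨hn, s, hs, hs0, hsn⟩, hmax⟩ := Set.exists_max_image
      {n ∈ S | ∃ s ∉ Submodule.span k (Set.range b), s ≠ 0 ∧ v s = n} id
      (hfinS.subset fun _ h => h.1)
      ⟨v s, ⟨s, fun h => hs (h ▸ zero_mem _), rfl⟩, s, hs, fun h => hs (h ▸ zero_mem _), rfl⟩
    obtain ⟨c, hc⟩ := hres s (b ⟨n, hn⟩) hs0 (hb0 _) (by rw [hsn, hbv])
    have hmem : c • b ⟨n, hn⟩ ∈ Submodule.span k (Set.range b) :=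
      Submodule.smul_mem _ _ (Submodule.subset_span ⟨_, rfl⟩)
    have hnot : s - c • b ⟨n, hn⟩ ∉ Submodule.span k (Set.range b) := fun h =>
      hs (by simpa using add_mem h hmem)
    have h0 : s - c • b ⟨n, hn⟩ ≠ 0 := fun h => hnot (h ▸ zero_mem _)
    have h1 := hc h0
    rw [hbv] at h1
    exact absurd (hmax _ ⟨⟨_, h0, rfl⟩, _, hnot, h0, rfl⟩) (not_le.mpr h1)
  refine ⟨?_, hfinS⟩
  rw [← Nat.card_coe_set_eq, Module.finrank_eq_nat_card_basis (Module.Basis.mk hli hspan)]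

namespace SmoothCurve

variable {k : Type u} [Field k] {Y : SmoothCurve k}

open TopologicalSpace

/-- Over an algebraically closed field, a function that is regular at a closed point takes a value
in `k` there. -/
lemma exists_scalar_sub_not_isUnit [IsAlgClosed k] {x : Y.X} (hx : IsClosed {x})
    (a : Y.X.presheaf.stalk x) :
    ∃ c : k, ¬ IsUnit (a - Y.X.presheaf.germ ⊤ x (Opens.mem_top x) (Y.scalars c)) := by
  let e := residueFieldIsoBase Y.str x hx
  have he : e.inv = CommRingCat.ofHom Y.scalars ≫
      Y.X.presheaf.germ ⊤ x (Opens.mem_top x) ≫ Y.X.residue x := by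
    have h1 := SpecMap_residueFieldIsoBase_inv Y.str x hx
    have hs : CommRingCat.ofHom Y.scalars = (Scheme.ΓSpecIso (.of k)).inv ≫ Y.str.appTop := rfl
    have hid : (Spec (Y.X.presheaf.stalk x)).presheaf.map (homOfLE le_top).op = 𝟙 _ :=
      (Spec (Y.X.presheaf.stalk x)).presheaf.map_id _
    have h2 : (Y.X.fromSpecStalk x).appTop =
        Y.X.presheaf.germ ⊤ x (Opens.mem_top x) ≫ (Scheme.ΓSpecIso (Y.X.presheaf.stalk x)).inv := by
      rw [Scheme.fromSpecStalk_appTop]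
      exact congrArg (Y.X.presheaf.germ ⊤ x (Opens.mem_top x) ≫ ·)
        (congrArg _ hid |>.trans (Category.comp_id _))
    rw [← cancel_mono (Scheme.ΓSpecIso _).inv, Scheme.ΓSpecIso_inv_naturality, h1, hs]
    simp only [Category.assoc]
    rw [Scheme.ΓSpecIso_inv_naturality, Scheme.fromSpecResidueField, Category.assoc,
      Scheme.Hom.comp_appTop, Scheme.Hom.comp_appTop, h2]
    simp only [Category.assoc]
  refine ⟨e.hom (Y.X.residue x a), fun h => ?_⟩
  have h2 : Y.X.residue x (a - Y.X.presheaf.germ ⊤ x (Opens.mem_top x)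
      (Y.scalars (e.hom (Y.X.residue x a)))) = 0 := by
    have h3 := ConcreteCategory.congr_hom he (e.hom (Y.X.residue x a))
    rw [_root_.map_sub, sub_eq_zero]
    refine Eq.trans ?_ h3
    exact (ConcreteCategory.congr_hom e.hom_inv_id (Y.X.residue x a)).symm
  have h4 := h.map (Y.X.residue x).hom
  rw [h2] at h4
  exact not_isUnit_zero h4

lemma exists_rationalEmbedding_hasDivisor {L : Y.X.Modules} (hL : IsLineBundle L) :
    ∃ (ρ : Y.RationalEmbedding L) (D : Y.X → ℤ), ρ.HasDivisor D := by
  obtain ⟨W, hW, e, he⟩ := hL (genericPoint Y.X)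
  have : Nonempty W := ⟨⟨_, hW⟩⟩
  obtain ⟨ρ, -⟩ := exists_rationalEmbedding hL he
  exact ⟨ρ, ρ.exists_hasDivisor hL⟩

namespace RationalEmbedding

variable {L : Y.X.Modules} {ρ : Y.RationalEmbedding L} {D : Y.X → ℤ}

/-- The rational function attached to a global section. -/
def global (ρ : Y.RationalEmbedding L) (s : Y.H0 L) : Y.X.functionField :=
  ρ.toFun ⊤ s

lemma global_add (s t : Y.H0 L) : ρ.global (s + t) = ρ.global s + ρ.global t := ρ.map_add ⊤ s t

lemma global_smul (c : k) (s : Y.H0 L) :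
    ρ.global (c • s) = Y.X.germToFunctionField ⊤ (Y.scalars c) * ρ.global s :=
  ρ.map_smul ⊤ (Y.scalars c) s

lemma global_ne_zero {s : Y.H0 L} (hs : s ≠ 0) : ρ.global s ≠ 0 := mt ρ.map_eq_zero.mp hs

lemma HasDivisor.ord_eq (hD : ρ.HasDivisor D) {s : Y.H0 L} (hs : s ≠ 0) (x : Y.X) :
    Y.ord s x = Scheme.ord (ρ.global s) x - D x :=
  hD.ordAt_eq (U := ⊤) hs x

lemma HasDivisor.ord_nonneg (hD : ρ.HasDivisor D) {s : Y.H0 L} (hs : s ≠ 0) (x : Y.X) :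
    0 ≤ Y.ord s x := by
  rw [hD.ord_eq hs]
  exact sub_nonneg.mpr (hD.le_ord (U := ⊤) hs trivial)

end RationalEmbedding

lemma ord_scalar {c : k} (hc : c ≠ 0) (x : Y.X) :
    Scheme.ord (Y.X.germToFunctionField ⊤ (Y.scalars c)) x = 0 :=
  Scheme.ord_of_isUnit ((isUnit_iff_ne_zero.mpr hc).map Y.scalars) trivial

/-- An `(r + 1)`-dimensional space of sections has `r + 1` orders of vanishing at a closed point. -/
lemma ncard_orders [IsAlgClosed k] {L : Y.X.Modules} (hL : IsLineBundle L)
    (V : Submodule k (Y.H0 L)) {r : ℕ} (hV : Module.finrank k V = r + 1) {x : Y.X}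
    (hx : IsClosed {x}) : (Y.orders V x).ncard = r + 1 ∧ (Y.orders V x).Finite := by
  obtain ⟨ρ, D, hD⟩ := exists_rationalEmbedding_hasDivisor hL
  have : FiniteDimensional k V := Module.finite_of_finrank_pos (by omega)
  have hne : ∀ s : V, s ≠ 0 → (s : Y.H0 L) ≠ 0 := fun s hs h => hs (Subtype.ext h)
  have key := ncard_values_eq_finrank (k := k) (fun s : V => Y.ord (s : Y.H0 L) x) ?_ ?_ ?_
  · have himg : {n | ∃ s : V, s ≠ 0 ∧ Y.ord (s : Y.H0 L) x = n} =
        (fun n : ℕ => (n : ℤ)) '' Y.orders V x := by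
      ext n
      constructor
      · rintro ⟨s, hs, rfl⟩
        have h := Int.toNat_of_nonneg (hD.ord_nonneg (hne s hs) x)
        exact ⟨(Y.ord (s : Y.H0 L) x).toNat, ⟨s, s.2, hne s hs, h.symm⟩, h⟩
      · rintro ⟨m, ⟨s, hs, hs0, h⟩, rfl⟩
        exact ⟨⟨s, hs⟩, fun h0 => hs0 (congrArg Subtype.val h0), h⟩
    rw [himg, Set.ncard_image_of_injective _ Nat.cast_injective, hV,
      Set.finite_image_iff Nat.cast_injective.injOn] at key
    exact key
  · intro s t hs ht hst
    rw [hD.ord_eq (hne _ hs), hD.ord_eq (hne _ ht), hD.ord_eq (hne _ hst)]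
    have h := ρ.global_add (s : Y.H0 L) t
    have h0 := ρ.global_ne_zero (hne _ hst)
    have h1 : ρ.global ((s + t : V) : Y.H0 L) = ρ.global s + ρ.global t := h
    rw [h1] at h0 ⊢
    have := Y.min_le_ord_add h0 x
    omega
  · intro c s hc hs
    have hcs := smul_ne_zero hc hs
    rw [hD.ord_eq (hne _ hs), hD.ord_eq (hne _ hcs)]
    have h1 : ρ.global ((c • s : V) : Y.H0 L) = _ := ρ.global_smul c (s : Y.H0 L)
    have h0 := ρ.global_ne_zero (hne _ hcs)
    rw [h1] at h0 ⊢
    rw [Scheme.ord_mul (left_ne_zero_of_mul h0) (right_ne_zero_of_mul h0), ord_scalar hc, zero_add]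
  · intro s t hs ht hst
    rw [hD.ord_eq (hne _ hs), hD.ord_eq (hne _ ht)] at hst
    have hs0 := ρ.global_ne_zero (hne _ hs)
    have ht0 := ρ.global_ne_zero (hne _ ht)
    -- The quotient of the two sections is regular at `x`; take for `c` its value there.
    obtain ⟨a, ha⟩ := (Y.ord_nonneg_iff (div_ne_zero hs0 ht0) x).mp (by
      rw [Y.ord_div hs0 ht0]; omega)
    obtain ⟨c, hc⟩ := exists_scalar_sub_not_isUnit hx a
    refine ⟨c, fun h0 => ?_⟩
    rw [hD.ord_eq (hne _ h0), hD.ord_eq (hne _ ht)]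
    have hg : ρ.global ((s - c • t : V) : Y.H0 L) =
        algebraMap _ _ (a - Y.X.presheaf.germ ⊤ x (Opens.mem_top x) (Y.scalars c)) *
          ρ.global t := by
      rw [_root_.map_sub, sub_mul, ha, div_mul_cancel₀ _ ht0,
        Scheme.algebraMap_germ_eq_germToFunctionField Y.X, ← ρ.global_smul, eq_sub_iff_add_eq,
        ← ρ.global_add]
      congr 1
      exact sub_add_cancel (s : Y.H0 L) (c • (t : Y.H0 L))
    have hg0 := ρ.global_ne_zero (hne _ h0)
    rw [hg] at hg0 ⊢
    have hb := left_ne_zero_of_mul hg0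
    rw [Scheme.ord_mul hb (right_ne_zero_of_mul hg0)]
    have hpos : 0 ≤ Scheme.ord (algebraMap _ Y.X.functionField
        (a - Y.X.presheaf.germ ⊤ x (Opens.mem_top x) (Y.scalars c))) x :=
      (Y.ord_nonneg_iff hb x).mpr ⟨_, rfl⟩
    have hzero : Scheme.ord (algebraMap _ Y.X.functionField
        (a - Y.X.presheaf.germ ⊤ x (Opens.mem_top x) (Y.scalars c))) x ≠ 0 := fun h => by
      obtain ⟨a', ha'⟩ := (Y.ord_nonneg_iff (inv_ne_zero hb) x).mp
        (by rw [Y.ord_inv hb, h, neg_zero])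
      apply hc
      refine IsUnit.of_mul_eq_one a' ?_
      apply IsFractionRing.injective (Y.X.presheaf.stalk x) Y.X.functionField
      rw [_root_.map_mul, ha', mul_inv_cancel₀ hb, _root_.map_one]
    omega

/-- `u_r` is the least order of vanishing. -/
lemma vanishingOrder_last_le {L : Y.X.Modules} {V : Submodule k (Y.H0 L)} {r : ℕ} {x : Y.X} {n : ℕ}
    (hn : n ∈ Y.orders V x) : Y.vanishingOrder V x r r ≤ n := by
  unfold vanishingOrder
  rw [Nat.sub_self, Nat.nth_zero]
  exact Nat.sInf_le hn

section VanishingOrder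

variable [IsAlgClosed k] {L : Y.X.Modules} (hL : IsLineBundle L)
  {V : Submodule k (Y.H0 L)} {r : ℕ} (hV : Module.finrank k V = r + 1) {x : Y.X}
  (hx : IsClosed {x})
include hL hV hx

lemma lt_card_orders {j : ℕ} (hj : j ≤ r) (hf : (Set.ofPred fun n => n ∈ Y.orders V x).Finite) :
    j < hf.toFinset.card := by
  have h : hf.toFinset.card = r + 1 := by
    rw [← Set.ncard_eq_toFinset_card _ hf]
    exact (ncard_orders hL V hV hx).1
  omega

lemma vanishingOrder_mem (t : ℕ) : Y.vanishingOrder V x r t ∈ Y.orders V x :=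
  Nat.nth_mem (p := fun n => n ∈ Y.orders V x) _ fun hf => lt_card_orders hL hV hx (by omega) hf

lemma le_vanishingOrder_zero : r ≤ Y.vanishingOrder V x r 0 :=
  Nat.le_nth (p := fun n => n ∈ Y.orders V x) fun hf => lt_card_orders hL hV hx (by omega) hf

/-- `u_0` is the greatest order of vanishing. -/
lemma le_vanishingOrder_first {n : ℕ} (hn : n ∈ Y.orders V x) :
    n ≤ Y.vanishingOrder V x r 0 := by
  have hf := (ncard_orders hL V hV hx).2
  obtain ⟨j, hj, rfl⟩ := Nat.exists_lt_card_finite_nth_eq (p := fun n => n ∈ Y.orders V x) hf hn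
  have h : hf.toFinset.card = r + 1 := by
    rw [← Set.ncard_eq_toFinset_card _ hf]
    exact (ncard_orders hL V hV hx).1
  have hr := lt_card_orders hL hV hx le_rfl hf
  exact Nat.nth_le_nth' (p := fun n => n ∈ Y.orders V x) (by omega) (fun _ => hr)

end VanishingOrder

end SmoothCurve

/-! ### Degree and twists in terms of rational embeddings -/

namespace SmoothCurve

variable {k : Type u} [Field k] {Y : SmoothCurve k}

open RationalEmbedding

section Degree

variable {L : Y.X.Modules} {ρ : Y.RationalEmbedding L} {D : Y.X → ℤ}

lemma RationalEmbedding.HasDivisor.exists_section_of_ne_zero (hD : ρ.HasDivisor D)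
    {f : Y.X.functionField} (hf : f ≠ 0) :
    ∃ (U : Y.X.Opens) (_ : Nonempty U) (s : Γ(L, U)), ρ.toFun U s = f := by
  have hcl := Y.isClosed_of_finite ((Y.finite_support_ord hf).union hD.finite) (by
    simp [Y.ord_genericPoint, hD.map_genericPoint])
  let U : Y.X.Opens := ⟨_, hcl.isOpen_compl⟩
  have hU : ∀ x ∈ U, Scheme.ord f x = 0 ∧ D x = 0 := fun x hx => by
    have hx' : x ∉ Function.support (Scheme.ord f) ∪ D.support := hx
    simpa using hx'
  have hn : Nonempty U := ⟨⟨genericPoint Y.X, by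
    change genericPoint Y.X ∉ Function.support (Scheme.ord f) ∪ D.support
    simp [Y.ord_genericPoint, hD.map_genericPoint]⟩⟩
  exact ⟨U, hn, (hD.exists_iff U f hf).mpr fun x hx => by rw [(hU x hx).1, (hU x hx).2]⟩

/-- As the nonzero rational sections correspond to the rational functions `f ≠ 0`, and have divisor
`div f - D`, the degree is `d` if and only if `deg (div f) = d + deg D` for all `f`. -/
lemma RationalEmbedding.HasDivisor.hasDegree_iff (hD : ρ.HasDivisor D) (d : ℤ) :
    HasDegree L d ↔
      ∀ f : Y.X.functionField, f ≠ 0 → ∑ᶠ x, Scheme.ord f x = d + ∑ᶠ x, D x := by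
  have key : ∀ (U : Y.X.Opens) [Nonempty U] (s : Γ(L, U)), s ≠ 0 →
      ∑ᶠ x, ordAt L s x = ∑ᶠ x, Scheme.ord (ρ.toFun U s) x - ∑ᶠ x, D x := fun U _ s hs => by
    rw [← finsum_sub_distrib (Y.finite_support_ord (mt ρ.map_eq_zero.mp hs)) hD.finite]
    exact finsum_congr fun x => hD.ordAt_eq hs x
  constructor
  · intro h f hf
    obtain ⟨U, _, s, rfl⟩ := hD.exists_section_of_ne_zero hf
    have hs := mt ρ.map_eq_zero.mpr hf
    have := key U s hs
    rw [h U s hs] at this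
    omega
  · intro h U s hs
    have : Nonempty U := by
      by_contra hU
      have := Y.subsingleton_of_isEmpty (L := L) hU
      exact hs (Subsingleton.elim _ _)
    rw [key U s hs, h _ (mt ρ.map_eq_zero.mp hs)]
    ring

end Degree

section Image

variable {L L' : Y.X.Modules} {ρ : Y.RationalEmbedding L} {ρ' : Y.RationalEmbedding L'}
  {D : Y.X → ℤ} {V : Submodule k (Y.H0 L)} {V' : Submodule k (Y.H0 L')}

lemma RationalEmbedding.HasDivisor.mem_orders_iff (hD : ρ.HasDivisor D) (x : Y.X) (m : ℕ) :
    m ∈ Y.orders V x ↔ ∃ f ∈ ρ.global '' V, f ≠ 0 ∧ Scheme.ord f x = D x + m := by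
  constructor
  · rintro ⟨s, hs, hs0, h⟩
    rw [hD.ord_eq hs0] at h
    exact ⟨_, ⟨s, hs, rfl⟩, ρ.global_ne_zero hs0, by omega⟩
  · rintro ⟨_, ⟨s, hs, rfl⟩, hs0, h⟩
    have hs0' : s ≠ 0 := mt ρ.map_eq_zero.mpr hs0
    exact ⟨s, hs, hs0', by rw [hD.ord_eq hs0']; omega⟩

lemma map_eq_of_image_eq (φ : L' ⟶ L)
    (hφ : ∀ (U : Y.X.Opens) [Nonempty U] (s' : Γ(L', U)),
      ρ.toFun U (φ.app U s') = ρ'.toFun U s') (h : ρ.global '' V = ρ'.global '' V') :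
    V'.map (Y.H0map φ) = V := by
  ext s
  constructor
  · rintro ⟨s', hs', rfl⟩
    obtain ⟨t, ht, hts⟩ : ρ'.global s' ∈ ρ.global '' V := h ▸ ⟨s', hs', rfl⟩
    have : Y.H0map φ s' = t := ρ.injective ⊤ ((hφ ⊤ s').trans hts.symm)
    rwa [this]
  · intro hs
    obtain ⟨s', hs', hss⟩ : ρ.global s ∈ ρ'.global '' V' := h ▸ ⟨s, hs, rfl⟩
    exact ⟨s', hs', ρ.injective ⊤ ((hφ ⊤ s').trans hss)⟩

lemma image_eq_of_map_eq (φ : L' ⟶ L)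
    (hφ : ∀ (U : Y.X.Opens) [Nonempty U] (s' : Γ(L', U)),
      ρ.toFun U (φ.app U s') = ρ'.toFun U s') (h : V'.map (Y.H0map φ) = V) :
    ρ.global '' V = ρ'.global '' V' := by
  subst h
  ext f
  constructor
  · rintro ⟨_, ⟨s', hs', rfl⟩, rfl⟩
    exact ⟨s', hs', (hφ ⊤ s').symm⟩
  · rintro ⟨s', hs', rfl⟩
    exact ⟨_, ⟨s', hs', rfl⟩, hφ ⊤ s'⟩

/-- Line bundles with spaces of sections are isomorphic if and only if they become the same divisor
and the same space of functions under suitable rational embeddings. -/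
lemma exists_iso_map_eq_iff (hD : ρ.HasDivisor D) :
    (∃ ψ : L ≅ L', V.map (Y.H0map ψ.hom) = V') ↔
      ∃ ρ' : Y.RationalEmbedding L', ρ'.HasDivisor D ∧ ρ.global '' V = ρ'.global '' V' := by
  constructor
  · rintro ⟨ψ, rfl⟩
    have h1 : ∀ (U : Y.X.Opens) (s : Γ(L', U)), ψ.hom.app U (ψ.inv.app U s) = s := fun U s =>
      ConcreteCategory.congr_hom (congrArg (fun φ : L' ⟶ L' => φ.app U) ψ.inv_hom_id) s
    have h2 : ∀ (U : Y.X.Opens) (s : Γ(L, U)), ψ.inv.app U (ψ.hom.app U s) = s := fun U s =>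
      ConcreteCategory.congr_hom (congrArg (fun φ : L ⟶ L => φ.app U) ψ.hom_inv_id) s
    have hinj : ∀ U : Y.X.Opens, Function.Injective (ψ.inv.app U) := fun U =>
      (show Function.LeftInverse (ψ.hom.app U) (ψ.inv.app U) from h1 U).injective
    refine ⟨ρ.comp ψ.inv hinj, ⟨hD.finite, hD.map_genericPoint, fun U _ f hf => ?_⟩, ?_⟩
    · rw [← hD.exists_iff U f hf]
      constructor
      · rintro ⟨s, rfl⟩
        exact ⟨_, rfl⟩
      · rintro ⟨s, rfl⟩
        exact ⟨ψ.hom.app U s, congrArg (ρ.toFun U) (h2 U s)⟩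
    · exact (image_eq_of_map_eq (ρ := ρ.comp ψ.inv hinj) (ρ' := ρ) ψ.hom
        (fun U _ s => congrArg (ρ.toFun U) (h2 U s)) rfl).symm
  · rintro ⟨ρ', hD', h⟩
    obtain ⟨ψ, hψ⟩ := RationalEmbedding.exists_iso hD' hD
    exact ⟨ψ, map_eq_of_image_eq ψ.hom hψ h.symm⟩

end Image

section Twist

variable {κ : Type v} (p : κ → Y.X) (n : κ → ℕ)

/-- The divisor `∑ n_c p_c`, for distinct points `p_c`. -/
def pointDivisor : Y.X → ℤ :=
  Function.extend p (fun c => (n c : ℤ)) 0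

variable {p n}

lemma pointDivisor_nonneg (x : Y.X) : 0 ≤ pointDivisor p n x := by
  classical
  unfold pointDivisor Function.extend
  split_ifs
  · exact Int.natCast_nonneg _
  · exact le_rfl

lemma pointDivisor_apply (hp : Function.Injective p) (c : κ) : pointDivisor p n (p c) = n c :=
  hp.extend_apply _ _ c

lemma pointDivisor_apply_of_notMem {x : Y.X} (hx : ¬ ∃ c, p c = x) : pointDivisor p n x = 0 :=
  Function.extend_apply' _ _ x hx

lemma support_pointDivisor_subset : Function.support (pointDivisor p n) ⊆ Set.range p := by
  intro x hx
  by_contra h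
  exact hx (pointDivisor_apply_of_notMem h)

lemma pointDivisor_genericPoint (hpc : ∀ c, IsClosed {p c}) :
    pointDivisor p n (genericPoint Y.X) = 0 :=
  pointDivisor_apply_of_notMem fun ⟨c, hc⟩ => Y.not_isClosed_genericPoint (hc ▸ hpc c)

open Classical in
lemma finsum_pointDivisor (hp : Function.Injective p) :
    ∑ᶠ x, pointDivisor p n x = ∑ᶠ c, (n c : ℤ) := by
  have h : ∑ᶠ x, pointDivisor p n x = ∑ᶠ x ∈ Set.range p, pointDivisor p n x :=
    finsum_congr fun x => by
      by_cases hx : x ∈ Set.range p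
      · rw [finsum_eq_if, if_pos hx]
      · rw [finsum_eq_if, if_neg hx, pointDivisor_apply_of_notMem hx]
  rw [h, finsum_mem_range hp]
  exact finsum_congr fun c => pointDivisor_apply hp c

lemma forall_add_pointDivisor_le_iff (hp : Function.Injective p) (D m : Y.X → ℤ)
    (U : Y.X.Opens) : (∀ x ∈ U, (D + pointDivisor p n) x ≤ m x) ↔
      (∀ x ∈ U, D x ≤ m x) ∧ ∀ c, p c ∈ U → D (p c) + n c ≤ m (p c) := by
  constructor
  · intro h
    refine ⟨fun x hx => ?_, fun c hc => ?_⟩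
    · have h1 := h x hx
      have h2 := pointDivisor_nonneg (p := p) (n := n) x
      rw [Pi.add_apply] at h1
      omega
    · have h1 := h _ hc
      rwa [Pi.add_apply, pointDivisor_apply hp] at h1
  · rintro ⟨h1, h2⟩ x hx
    rw [Pi.add_apply]
    by_cases hc : ∃ c, p c = x
    · obtain ⟨c, rfl⟩ := hc
      rw [pointDivisor_apply hp]
      exact h2 c hx
    · rw [pointDivisor_apply_of_notMem hc, add_zero]
      exact h1 x hx

variable {L L' : Y.X.Modules} {ρ : Y.RationalEmbedding L} {ρ' : Y.RationalEmbedding L'}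
  {D : Y.X → ℤ} {V : Submodule k (Y.H0 L)} {V' : Submodule k (Y.H0 L')}

/-- The divisor condition on a section of `L(-∑ n_c p_c)` as a rational function. -/
lemma RationalEmbedding.HasDivisor.forall_vanishesToOrder_iff (hD : ρ.HasDivisor D)
    (hp : Function.Injective p) {U : Y.X.Opens} [Nonempty U] {s : Γ(L, U)} (hs : s ≠ 0) :
    (∀ c, p c ∈ U → VanishesToOrder L s (p c) (n c)) ↔
      ∀ x ∈ U, (D + pointDivisor p n) x ≤ Scheme.ord (ρ.toFun U s) x := by
  rw [forall_add_pointDivisor_le_iff hp]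
  constructor
  · intro h
    refine ⟨fun x hx => hD.le_ord hs hx, fun c hc => ?_⟩
    have h1 := (h c hc).resolve_left hs
    rw [hD.ordAt_eq hs] at h1
    omega
  · rintro ⟨-, h⟩ c hc
    right
    rw [hD.ordAt_eq hs]
    have := h c hc
    omega

lemma RationalEmbedding.HasDivisor.comp_twist [Finite κ] (hD : ρ.HasDivisor D)
    (hp : Function.Injective p) (hpc : ∀ c, IsClosed {p c}) (φ : L' ⟶ L)
    (hφ : ∀ U : Y.X.Opens, Function.Injective (φ.app U))
    (himg : ∀ (U : Y.X.Opens) (s : Γ(L, U)), (∃ s' : Γ(L', U), φ.app U s' = s) ↔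
      ∀ c, p c ∈ U → VanishesToOrder L s (p c) (n c)) :
    (ρ.comp φ hφ).HasDivisor (D + pointDivisor p n) := by
  refine ⟨?_, ?_, fun U _ f hf => ?_⟩
  · exact (hD.finite.union ((Set.finite_range p).subset support_pointDivisor_subset)).subset
      (Function.support_add _ _)
  · rw [Pi.add_apply, hD.map_genericPoint, pointDivisor_genericPoint hpc, add_zero]
  · constructor
    · rintro ⟨s', rfl⟩
      exact (hD.forall_vanishesToOrder_iff hp (mt ρ.map_eq_zero.mpr hf)).mp
        ((himg U _).mp ⟨s', rfl⟩)
    · intro h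
      obtain ⟨s, rfl⟩ := (hD.exists_iff U f hf).mpr
        ((forall_add_pointDivisor_le_iff hp _ _ _).mp h).1
      obtain ⟨s', hs'⟩ := (himg U s).mpr
        ((hD.forall_vanishesToOrder_iff hp (mt ρ.map_eq_zero.mpr hf)).mpr h)
      exact ⟨s', congrArg (ρ.toFun U) hs'⟩

/-- If the divisors of `L` and `L'` differ by `∑ n_c p_c`, the inclusion of the functions in `L'` in
those in `L` is the inclusion of the sections that vanish to order at least `n_c` at `p_c`. -/
lemma exists_twistHom (hp : Function.Injective p) (hD : ρ.HasDivisor D)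
    (hD' : ρ'.HasDivisor (D + pointDivisor p n)) :
    ∃ φ : L' ⟶ L, (∀ (U : Y.X.Opens) [Nonempty U] (s' : Γ(L', U)),
        ρ.toFun U (φ.app U s') = ρ'.toFun U s') ∧
      (∀ U : Y.X.Opens, Function.Injective (φ.app U)) ∧
      ∀ (U : Y.X.Opens) (s : Γ(L, U)), (∃ s' : Γ(L', U), φ.app U s' = s) ↔
        ∀ c, p c ∈ U → VanishesToOrder L s (p c) (n c) := by
  obtain ⟨φ, hφ⟩ := exists_hom_of_le ρ ρ' fun U _ s' => by
    by_cases hs : s' = 0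
    · exact ⟨0, by rw [ρ.map_zero, hs, ρ'.map_zero]⟩
    · exact (hD.exists_iff U _ (mt ρ'.map_eq_zero.mp hs)).mpr
        ((forall_add_pointDivisor_le_iff hp _ _ _).mp fun x hx => hD'.le_ord hs hx).1
  refine ⟨φ, hφ, fun U => ?_, fun U s => ?_⟩
  · by_cases hU : Nonempty U
    · intro s t hst
      apply ρ'.injective U
      rw [← hφ, ← hφ, hst]
    · have := Y.subsingleton_of_isEmpty (L := L') hU
      exact fun s t _ => Subsingleton.elim _ _
  · by_cases hU : Nonempty U
    · by_cases hs : s = 0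
      · exact ⟨fun _ c _ => .inl hs, fun _ => ⟨0, by rw [hs, _root_.map_zero]⟩⟩
      · rw [hD.forall_vanishesToOrder_iff hp hs, ← hD'.exists_iff U _ (mt ρ.map_eq_zero.mp hs)]
        refine exists_congr fun s' => ?_
        rw [← hφ, (ρ.injective U).eq_iff]
    · have := Y.subsingleton_of_isEmpty (L := L) hU
      exact ⟨fun _ c hc => absurd ⟨⟨_, hc⟩⟩ hU, fun _ => ⟨0, Subsingleton.elim _ _⟩⟩

/-- A twist in terms of rational embeddings: the divisor changes by `∑ n_c p_c`, the space of
functions remains the same. -/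
lemma isTwist_iff [Finite κ] (hD : ρ.HasDivisor D) (hp : Function.Injective p)
    (hpc : ∀ c, IsClosed {p c}) : Y.IsTwist p n L V L' V' ↔
      ∃ ρ' : Y.RationalEmbedding L', ρ'.HasDivisor (D + pointDivisor p n) ∧
        ρ.global '' V = ρ'.global '' V' := by
  constructor
  · rintro ⟨φ, hφ, himg, h⟩
    exact ⟨ρ.comp φ hφ, hD.comp_twist hp hpc φ hφ himg,
      image_eq_of_map_eq φ (fun _ _ _ => rfl) h⟩
  · rintro ⟨ρ', hD', h⟩
    obtain ⟨φ, h1, h2, h3⟩ := exists_twistHom hp hD hD'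
    exact ⟨φ, h2, h3, map_eq_of_image_eq φ h1 h⟩

namespace IsTwist

lemma finrank_eq (h : Y.IsTwist p n L V L' V') : Module.finrank k V = Module.finrank k V' := by
  obtain ⟨φ, hφ, -, rfl⟩ := h
  exact (Submodule.equivMapOfInjective (Y.H0map φ) (hφ ⊤) V').finrank_eq.symm

variable [Finite κ] (h : Y.IsTwist p n L V L' V') (hL : IsLineBundle L)
  (hp : Function.Injective p) (hpc : ∀ c, IsClosed {p c})
include h hL hp hpc

lemma hasDegree_iff (d : ℤ) : HasDegree L d ↔ HasDegree L' (d - ∑ᶠ c, (n c : ℤ)) := by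
  obtain ⟨ρ, D, hD⟩ := exists_rationalEmbedding_hasDivisor hL
  obtain ⟨ρ', hD', -⟩ := (isTwist_iff hD hp hpc).mp h
  rw [hD.hasDegree_iff, hD'.hasDegree_iff]
  have hsum : ∑ᶠ x, (D + pointDivisor p n) x = ∑ᶠ x, D x + ∑ᶠ c, (n c : ℤ) := by
    rw [← finsum_pointDivisor hp]
    exact finsum_add_distrib hD.finite ((Set.finite_range p).subset support_pointDivisor_subset)
  rw [hsum]
  refine forall₂_congr fun f _ => ?_
  constructor <;> intro h <;> linarith

lemma mem_orders_iff (c : κ) (m : ℕ) :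
    m ∈ Y.orders V (p c) ↔ ∃ m' ∈ Y.orders V' (p c), m' + n c = m := by
  obtain ⟨ρ, D, hD⟩ := exists_rationalEmbedding_hasDivisor hL
  obtain ⟨ρ', hD', himg⟩ := (isTwist_iff hD hp hpc).mp h
  rw [hD.mem_orders_iff]
  simp only [hD'.mem_orders_iff, himg, Pi.add_apply, pointDivisor_apply hp]
  constructor
  · rintro ⟨_, ⟨s, hs, rfl⟩, hf0, hf⟩
    have h1 := hD'.le_ord (U := ⊤) (s := s) (mt ρ'.map_eq_zero.mpr hf0) (x := p c) trivial
    rw [Pi.add_apply, pointDivisor_apply hp] at h1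
    change _ ≤ Scheme.ord (ρ'.global s) (p c) at h1
    exact ⟨m - n c, ⟨_, ⟨s, hs, rfl⟩, hf0, by omega⟩, by omega⟩
  · rintro ⟨m', ⟨f, hf, hf0, h⟩, rfl⟩
    exact ⟨f, hf, hf0, by push_cast; omega⟩

/-- A twist shifts the orders of vanishing. -/
lemma vanishingOrder_eq [IsAlgClosed k] {r : ℕ} (hV : Module.finrank k V = r + 1) (c : κ) (t : ℕ) :
    Y.vanishingOrder V (p c) r t = Y.vanishingOrder V' (p c) r t + n c := by
  have hmono : StrictMono (fun m : ℕ => m + n c) := fun a b hab => Nat.add_lt_add_right hab _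
  have hiff := h.mem_orders_iff hL hp hpc c
  have := Nat.nth_comp_of_strictMono (p := fun m => m ∈ Y.orders V (p c)) (n := r - t) hmono
    (fun m hm => by
      obtain ⟨m', -, rfl⟩ := (hiff m).mp hm
      exact ⟨m', rfl⟩)
    (fun hf => lt_card_orders hL hV (hpc c) (by omega) hf)
  unfold vanishingOrder
  rw [← this]
  congr 2
  funext m
  refine propext ⟨fun hm => ?_, fun hm => (hiff _).mpr ⟨m, hm, rfl⟩⟩
  obtain ⟨m', hm', he⟩ := (hiff _).mp hm
  obtain rfl : m' = m := by omega
  exact hm'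

end IsTwist

/-- The twist `L(-∑ n_c p_c)` exists, and the sections in `V` are sections of it if they vanish to
order at least `n_c` at `p_c`. -/
lemma exists_isTwist_sub [Finite κ] (hL : IsLineBundle L) (hp : Function.Injective p)
    (hpc : ∀ c, IsClosed {p c})
    (hV : ∀ s ∈ V, s ≠ 0 → ∀ c, (n c : ℤ) ≤ Y.ord s (p c)) :
    ∃ (L' : Y.X.Modules) (V' : Submodule k (Y.H0 L')), IsLineBundle L' ∧
      Y.IsTwist p n L V L' V' := by
  obtain ⟨ρ, D, hD⟩ := exists_rationalEmbedding_hasDivisor hL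
  obtain ⟨L', ρ', hD'⟩ := exists_hasDivisor_of_finite (D := D + pointDivisor p n)
    ((hD.finite.union ((Set.finite_range p).subset support_pointDivisor_subset)).subset
      (Function.support_add _ _))
    (by rw [Pi.add_apply, hD.map_genericPoint, pointDivisor_genericPoint hpc, add_zero])
  obtain ⟨φ, -, h2, h3⟩ := exists_twistHom hp hD hD'
  refine ⟨L', V.comap (Y.H0map φ), hD'.isLineBundle, φ, h2, h3, ?_⟩
  rw [Submodule.map_comap_eq, inf_eq_right]
  intro s hs
  by_cases hs0 : s = 0
  · exact hs0 ▸ zero_mem _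
  · obtain ⟨s', hs'⟩ := (h3 ⊤ s).mpr fun c _ => .inr (hV s hs hs0 c)
    exact ⟨s', hs'⟩

/-- The twist `L'(∑ n_c p_c)` exists. -/
lemma exists_isTwist_add [Finite κ] (hL' : IsLineBundle L') (hp : Function.Injective p)
    (hpc : ∀ c, IsClosed {p c}) (n : κ → ℕ) (V' : Submodule k (Y.H0 L')) :
    ∃ (L : Y.X.Modules) (V : Submodule k (Y.H0 L)), IsLineBundle L ∧
      Y.IsTwist p n L V L' V' := by
  obtain ⟨ρ', D', hD'⟩ := exists_rationalEmbedding_hasDivisor hL'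
  obtain ⟨L, ρ, hD⟩ := exists_hasDivisor_of_finite (D := D' - pointDivisor p n)
    ((hD'.finite.union ((Set.finite_range p).subset support_pointDivisor_subset)).subset
      (Function.support_sub _ _))
    (by rw [Pi.sub_apply, hD'.map_genericPoint, pointDivisor_genericPoint hpc, sub_zero])
  obtain ⟨φ, -, h2, h3⟩ := exists_twistHom (ρ' := ρ') (n := n) hp hD (by rwa [sub_add_cancel])
  exact ⟨L, V'.map (Y.H0map φ), hD.isLineBundle, φ, h2, h3, rfl⟩

end Twist

end SmoothCurve

/-! ### Isomorphisms, and uniqueness of twists -/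

namespace SmoothCurve

variable {k : Type u} [Field k] {Y : SmoothCurve k}

open RationalEmbedding

section Iso

variable {L L₁ L₂ L' : Y.X.Modules} {V : Submodule k (Y.H0 L)} {V₁ : Submodule k (Y.H0 L₁)}
  {V₂ : Submodule k (Y.H0 L₂)} {V' : Submodule k (Y.H0 L')}

lemma RationalEmbedding.HasDivisor.scale {ρ : Y.RationalEmbedding L} {D : Y.X → ℤ}
    (hD : ρ.HasDivisor D) {c : Y.X.functionField} (hc : c ≠ 0) :
    (ρ.scale hc).HasDivisor (D + Scheme.ord c) := by
  refine ⟨(hD.finite.union (Y.finite_support_ord hc)).subset (Function.support_add _ _), ?_,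
    fun U _ f hf => ?_⟩
  · rw [Pi.add_apply, hD.map_genericPoint, Y.ord_genericPoint, add_zero]
  · have h0 : f / c ≠ 0 := div_ne_zero hf hc
    have h1 : (∃ s, (ρ.scale hc).toFun U s = f) ↔ ∃ s, ρ.toFun U s = f / c :=
      exists_congr fun s => by
      rw [eq_div_iff hc, mul_comm]
      rfl
    rw [h1, hD.exists_iff U _ h0]
    refine forall₂_congr fun x _ => ?_
    rw [Y.ord_div hf hc, Pi.add_apply, le_sub_iff_add_le]

lemma orders_eq_of_iso (hL : IsLineBundle L₁) (h : ∃ ψ : L₁ ≅ L₂, V₁.map (Y.H0map ψ.hom) = V₂)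
    (x : Y.X) : Y.orders V₁ x = Y.orders V₂ x := by
  obtain ⟨ρ, D, hD⟩ := exists_rationalEmbedding_hasDivisor hL
  obtain ⟨ρ', hD', himg⟩ := (exists_iso_map_eq_iff hD).mp h
  ext m
  rw [hD.mem_orders_iff, hD'.mem_orders_iff, himg]

lemma vanishingOrder_eq_of_iso (hL : IsLineBundle L₁)
    (h : ∃ ψ : L₁ ≅ L₂, V₁.map (Y.H0map ψ.hom) = V₂) (x : Y.X) (r t : ℕ) :
    Y.vanishingOrder V₁ x r t = Y.vanishingOrder V₂ x r t := by
  unfold vanishingOrder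
  rw [orders_eq_of_iso hL h]

lemma exists_iso_symm (h : ∃ ψ : L₁ ≅ L₂, V₁.map (Y.H0map ψ.hom) = V₂) :
    ∃ ψ : L₂ ≅ L₁, V₂.map (Y.H0map ψ.hom) = V₁ := by
  obtain ⟨ψ, rfl⟩ := h
  refine ⟨ψ.symm, ?_⟩
  rw [← Submodule.map_comp]
  convert Submodule.map_id V₁
  ext s
  exact ConcreteCategory.congr_hom (congrArg (fun φ : L₁ ⟶ L₁ => φ.app ⊤) ψ.hom_inv_id) s

lemma exists_iso_trans (h : ∃ ψ : L ≅ L₁, V.map (Y.H0map ψ.hom) = V₁)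
    (h' : ∃ ψ : L₁ ≅ L₂, V₁.map (Y.H0map ψ.hom) = V₂) :
    ∃ ψ : L ≅ L₂, V.map (Y.H0map ψ.hom) = V₂ := by
  obtain ⟨ψ, rfl⟩ := h
  obtain ⟨ψ', rfl⟩ := h'
  exact ⟨ψ ≪≫ ψ', Submodule.map_comp (Y.H0map ψ.hom) (Y.H0map ψ'.hom) V⟩

lemma exists_iso_refl (V : Submodule k (Y.H0 L)) : ∃ ψ : L ≅ L, V.map (Y.H0map ψ.hom) = V :=
  ⟨Iso.refl L, Submodule.map_id V⟩

lemma HasDegree.unique {d d' : ℤ} (hL : IsLineBundle L) (h : HasDegree L d) (h' : HasDegree L d') :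
    d = d' := by
  obtain ⟨ρ, D, hD⟩ := exists_rationalEmbedding_hasDivisor hL
  have h1 := (hD.hasDegree_iff d).mp h 1 one_ne_zero
  have h2 := (hD.hasDegree_iff d').mp h' 1 one_ne_zero
  omega

/-- The order of vanishing of a section at a point is at most the degree. -/
lemma HasDegree.ord_le {d : ℤ} (hL : IsLineBundle L) (h : HasDegree L d) {s : Y.H0 L} (hs : s ≠ 0)
    (x : Y.X) : Y.ord s x ≤ d := by
  obtain ⟨ρ, D, hD⟩ := exists_rationalEmbedding_hasDivisor hL
  rw [← h ⊤ s hs]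
  refine single_le_finsum (f := fun x => Y.ord s x) x ?_ fun x => hD.ord_nonneg hs x
  refine ((Y.finite_support_ord (ρ.global_ne_zero hs)).union hD.finite).subset fun y hy => ?_
  by_contra h
  simp only [Set.mem_union, Function.mem_support, not_or, not_not] at h
  apply hy
  dsimp only
  rw [hD.ord_eq hs, h.1, h.2, sub_zero]

namespace IsTwist

variable {κ : Type v} [Finite κ] {p : κ → Y.X} {n : κ → ℕ}
  (hp : Function.Injective p) (hpc : ∀ c, IsClosed {p c})
include hp hpc

lemma of_iso_left (hL : IsLineBundle L₁) (h : Y.IsTwist p n L₁ V₁ L' V')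
    (hψ : ∃ ψ : L₁ ≅ L₂, V₁.map (Y.H0map ψ.hom) = V₂) : Y.IsTwist p n L₂ V₂ L' V' := by
  obtain ⟨ρ, D, hD⟩ := exists_rationalEmbedding_hasDivisor hL
  obtain ⟨ρ₂, hD₂, himg⟩ := (exists_iso_map_eq_iff hD).mp hψ
  rw [isTwist_iff hD₂ hp hpc, ← himg]
  exact (isTwist_iff hD hp hpc).mp h

lemma of_iso_right (hL : IsLineBundle L) (h : Y.IsTwist p n L V L₁ V₁)
    (hψ : ∃ ψ : L₁ ≅ L₂, V₁.map (Y.H0map ψ.hom) = V₂) : Y.IsTwist p n L V L₂ V₂ := by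
  obtain ⟨ρ, D, hD⟩ := exists_rationalEmbedding_hasDivisor hL
  obtain ⟨ρ₁, hD₁, himg⟩ := (isTwist_iff hD hp hpc).mp h
  obtain ⟨ρ₂, hD₂, himg₂⟩ := (exists_iso_map_eq_iff hD₁).mp hψ
  exact (isTwist_iff hD hp hpc).mpr ⟨ρ₂, hD₂, himg.trans himg₂⟩

lemma unique_right (hL : IsLineBundle L) (h₁ : Y.IsTwist p n L V L₁ V₁)
    (h₂ : Y.IsTwist p n L V L₂ V₂) : ∃ ψ : L₁ ≅ L₂, V₁.map (Y.H0map ψ.hom) = V₂ := by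
  obtain ⟨ρ, D, hD⟩ := exists_rationalEmbedding_hasDivisor hL
  obtain ⟨ρ₁, hD₁, himg₁⟩ := (isTwist_iff hD hp hpc).mp h₁
  obtain ⟨ρ₂, hD₂, himg₂⟩ := (isTwist_iff hD hp hpc).mp h₂
  exact (exists_iso_map_eq_iff hD₁).mpr ⟨ρ₂, hD₂, himg₁.symm.trans himg₂⟩

/-- A line bundle is determined by a twist: the two rational embeddings of `L'` that it inherits
from `L₁` and `L₂` differ by a rational function `c`, by which one of them can be rescaled. -/
lemma unique_left (hL₁ : IsLineBundle L₁) (hL₂ : IsLineBundle L₂)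
    (h₁ : Y.IsTwist p n L₁ V₁ L' V') (h₂ : Y.IsTwist p n L₂ V₂ L' V') :
    ∃ ψ : L₁ ≅ L₂, V₁.map (Y.H0map ψ.hom) = V₂ := by
  obtain ⟨ρ₁, D₁, hD₁⟩ := exists_rationalEmbedding_hasDivisor hL₁
  obtain ⟨ρ₁', hD₁', himg₁⟩ := (isTwist_iff hD₁ hp hpc).mp h₁
  obtain ⟨ρ₂, D₂, hD₂⟩ := exists_rationalEmbedding_hasDivisor hL₂
  obtain ⟨ρ₂', hD₂', himg₂⟩ := (isTwist_iff hD₂ hp hpc).mp h₂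
  obtain ⟨c, hc, hcρ⟩ := exists_eq_mul hD₁'.isLineBundle ρ₂' ρ₁'
  obtain rfl : ρ₁' = ρ₂'.scale hc := by
    cases ρ₁'
    simp only [RationalEmbedding.scale, RationalEmbedding.mk.injEq]
    funext U _ s
    exact hcρ U s
  have hDD : D₂ + Scheme.ord c = D₁ := by
    have h := hD₁'.unique (hD₂'.scale hc)
    rw [add_right_comm] at h
    exact (add_right_cancel h).symm
  refine (exists_iso_map_eq_iff hD₁).mpr ⟨ρ₂.scale hc, hDD ▸ hD₂.scale hc, himg₁.trans ?_⟩
  have h1 : (ρ₂.scale hc).global '' V₂ = (c * ·) '' (ρ₂.global '' V₂) :=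
    Set.image_comp (c * ·) ρ₂.global V₂
  have h2 : (ρ₂'.scale hc).global '' V' = (c * ·) '' (ρ₂'.global '' V') :=
    Set.image_comp (c * ·) ρ₂'.global V'
  rw [h1, h2, himg₂]

end IsTwist

end Iso

end SmoothCurve

/-! ### Branches of a tree -/

section Tree

variable {ι : Type v} (G : SimpleGraph ι)

/-- The vertices that can be reached from `j` without passing through `i`. -/
def branchSet (i j : ι) : Set ι :=
  {m | ∃ p : G.Walk j m, i ∉ p.support}

/-- The edges with an end point in the branch. -/
def branchEdges (i j : ι) : Set G.edgeSet :=
  {α | ∃ m ∈ branchSet G i j, m ∈ α.1}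

variable {G} {i j l m : ι}

lemma mem_branchSet_self (h : i ≠ j) : j ∈ branchSet G i j :=
  ⟨.nil, by simpa using h⟩

lemma left_notMem_branchSet : i ∉ branchSet G i j := fun ⟨p, hp⟩ => hp p.end_mem_support

lemma mem_branchSet_of_adj (hm : m ∈ branchSet G i j) (h : G.Adj m l) (hl : l ≠ i) :
    l ∈ branchSet G i j := by
  obtain ⟨p, hp⟩ := hm
  refine ⟨p.concat h, ?_⟩
  rw [SimpleGraph.Walk.support_concat, List.mem_append, List.mem_singleton, not_or]
  exact ⟨hp, hl.symm⟩

lemma exists_mem_branchSet (hG : G.Connected) (hm : m ≠ i) :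
    ∃ j, G.Adj i j ∧ m ∈ branchSet G i j := by
  classical
  obtain ⟨p, hp⟩ := (hG i m).exists_isPath
  cases p with
  | nil => exact absurd rfl hm
  | cons h p => exact ⟨_, h, p, ((SimpleGraph.Walk.cons_isPath_iff _ _).mp hp).2⟩

section Acyclic

variable (hG : G.IsAcyclic)
include hG

lemma mem_edges_of_isAcyclic (h : G.Adj i j) (p : G.Walk j i) : s(i, j) ∈ p.edges := by
  have := SimpleGraph.isBridge_iff_forall_walk_mem_edges.mp
    (SimpleGraph.isAcyclic_iff_forall_adj_isBridge.mp hG h)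
  simpa using this p.reverse

lemma disjoint_branchSet_swap (h : G.Adj i j) (hm : m ∈ branchSet G i j) :
    m ∉ branchSet G j i := by
  rintro ⟨q, hq⟩
  obtain ⟨p, hp⟩ := hm
  have := mem_edges_of_isAcyclic hG h (p.append q.reverse)
  rw [SimpleGraph.Walk.edges_append, List.mem_append, SimpleGraph.Walk.edges_reverse,
    List.mem_reverse] at this
  rcases this with h1 | h1
  · exact hp (p.fst_mem_support_of_mem_edges h1)
  · exact hq (q.snd_mem_support_of_mem_edges h1)

lemma eq_of_mem_branchSet (hj : G.Adj i j) (hl : G.Adj i l) (hm : m ∈ branchSet G i j)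
    (hm' : m ∈ branchSet G i l) : j = l := by
  obtain ⟨p, hp⟩ := hm
  obtain ⟨q, hq⟩ := hm'
  have := mem_edges_of_isAcyclic hG hj ((p.append q.reverse).concat hl.symm)
  rw [SimpleGraph.Walk.edges_concat, List.concat_eq_append, SimpleGraph.Walk.edges_append,
    List.mem_append, List.mem_append, SimpleGraph.Walk.edges_reverse, List.mem_reverse,
    List.mem_singleton] at this
  rcases this with (h1 | h1) | h1
  · exact absurd (p.fst_mem_support_of_mem_edges h1) hp
  · exact absurd (q.fst_mem_support_of_mem_edges h1) hq
  · rw [Sym2.eq_swap] at h1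
    exact Sym2.congr_left.mp h1

lemma branchSet_subset (h : G.Adj i j) (hl : G.Adj j l) (hli : l ≠ i) :
    branchSet G j l ⊆ branchSet G i j := by
  classical
  rintro m ⟨q, hq⟩
  refine ⟨.cons hl q, ?_⟩
  rw [SimpleGraph.Walk.support_cons, List.mem_cons, not_or]
  refine ⟨h.ne, fun hi => hli ?_⟩
  refine eq_of_mem_branchSet hG hl h.symm (m := i) ⟨q.takeUntil i hi, fun hj => hq ?_⟩
    (mem_branchSet_self h.ne')
  exact q.support_takeUntil_subset_support hi hj

end Acyclic

section IsTree

variable (hG : G.IsTree)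
include hG

lemma compl_branchSet (h : G.Adj i j) : (branchSet G i j)ᶜ = branchSet G j i := by
  classical
  ext m
  refine ⟨fun hm => ?_, fun hm => disjoint_branchSet_swap hG.isAcyclic h.symm hm⟩
  by_cases hmi : m = i
  · subst hmi
    exact mem_branchSet_self h.ne'
  obtain ⟨l, hl, q, hq⟩ := exists_mem_branchSet hG.connected hmi
  refine ⟨.cons hl q, ?_⟩
  rw [SimpleGraph.Walk.support_cons, List.mem_cons, not_or]
  refine ⟨h.ne', fun hj => ?_⟩
  have hlj : l = j := eq_of_mem_branchSet hG.isAcyclic hl h (m := j)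
    ⟨q.takeUntil j hj, fun hi => hq (q.support_takeUntil_subset_support hj hi)⟩
    (mem_branchSet_self h.ne)
  subst hlj
  exact hm ⟨q, hq⟩

lemma branchEdges_union (h : G.Adj i j) : branchEdges G i j ∪ branchEdges G j i = Set.univ := by
  refine Set.eq_univ_of_forall ?_
  rintro ⟨e, he⟩
  induction e with | h m m' =>
  by_cases hm : m ∈ branchSet G i j
  · exact .inl ⟨m, hm, Sym2.mem_mk_left _ _⟩
  · refine .inr ⟨m, ?_, Sym2.mem_mk_left _ _⟩
    rwa [← compl_branchSet hG h]

lemma branchEdges_inter (h : G.Adj i j) :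
    branchEdges G i j ∩ branchEdges G j i = {⟨s(i, j), h⟩} := by
  ext ⟨e, he⟩
  constructor
  · rintro ⟨⟨m, hm, hme⟩, ⟨m', hm', hme'⟩⟩
    have hne : m ≠ m' := fun h' => disjoint_branchSet_swap hG.isAcyclic h hm (h' ▸ hm')
    obtain rfl : e = s(m, m') := ((Sym2.mem_and_mem_iff hne).mp ⟨hme, hme'⟩)
    have hadj : G.Adj m m' := he
    have h1 : m' = i := by
      by_contra h1
      exact disjoint_branchSet_swap hG.isAcyclic h (mem_branchSet_of_adj hm hadj h1) hm'
    have h2 : m = j := by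
      by_contra h2
      exact disjoint_branchSet_swap hG.isAcyclic h hm (mem_branchSet_of_adj hm' hadj.symm h2)
    subst h1 h2
    exact Subtype.ext Sym2.eq_swap
  · intro he'
    have : e = s(i, j) := congrArg Subtype.val he'
    subst this
    exact ⟨⟨j, mem_branchSet_self h.ne, Sym2.mem_mk_right _ _⟩,
      ⟨i, mem_branchSet_self h.ne', Sym2.mem_mk_left _ _⟩⟩

lemma iUnion_branchSet (i : ι) : ⋃ j : G.neighborSet i, branchSet G i j = {i}ᶜ := by
  ext m
  rw [Set.mem_iUnion]
  constructor
  · rintro ⟨j, hj⟩ rfl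
    exact left_notMem_branchSet hj
  · intro hm
    obtain ⟨j, hj, h⟩ := exists_mem_branchSet hG.connected hm
    exact ⟨⟨j, hj⟩, h⟩

lemma iUnion_branchEdges (i : ι) : ⋃ j : G.neighborSet i, branchEdges G i j = Set.univ := by
  refine Set.eq_univ_of_forall ?_
  rintro ⟨e, he⟩
  induction e with | h m m' =>
  rw [Set.mem_iUnion]
  by_cases hm : m = i
  · have hm' : m' ≠ i := fun h => (show G.Adj m m' from he).ne (hm.trans h.symm)
    obtain ⟨j, hj, h⟩ := exists_mem_branchSet hG.connected hm'
    exact ⟨⟨j, hj⟩, m', h, Sym2.mem_mk_right _ _⟩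
  · obtain ⟨j, hj, h⟩ := exists_mem_branchSet hG.connected hm
    exact ⟨⟨j, hj⟩, m, h, Sym2.mem_mk_left _ _⟩

lemma pairwise_disjoint_branchSet (i : ι) :
    Pairwise (Function.onFun Disjoint fun j : G.neighborSet i => branchSet G i j) := by
  intro j l hjl
  refine Set.disjoint_left.mpr fun m hm hm' => hjl ?_
  exact Subtype.ext (eq_of_mem_branchSet hG.isAcyclic j.2 l.2 hm hm')

lemma pairwise_disjoint_branchEdges (i : ι) :
    Pairwise (Function.onFun Disjoint fun j : G.neighborSet i => branchEdges G i j) := by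
  intro j l hjl
  refine Set.disjoint_left.mpr ?_
  rintro ⟨e, he⟩ ⟨m, hm, hme⟩ ⟨m', hm', hme'⟩
  apply hjl
  apply Subtype.ext
  by_cases hmm : m = m'
  · exact eq_of_mem_branchSet hG.isAcyclic j.2 l.2 hm (hmm ▸ hm')
  · obtain rfl : e = s(m, m') := ((Sym2.mem_and_mem_iff hmm).mp ⟨hme, hme'⟩)
    have hadj : G.Adj m m' := he
    refine eq_of_mem_branchSet hG.isAcyclic j.2 l.2 (mem_branchSet_of_adj hm hadj ?_) hm'
    rintro rfl
    exact left_notMem_branchSet hm'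

/-- Induction on the oriented edges of a finite tree, from the leaves inwards. -/
lemma adj_induction [Finite ι] {P : ι → ι → Prop}
    (step : ∀ i j, G.Adj i j → (∀ l, G.Adj j l → l ≠ i → P j l) → P i j) :
    ∀ i j, G.Adj i j → P i j := by
  suffices ∀ n i j, G.Adj i j → (branchSet G i j).ncard = n → P i j from
    fun i j h => this _ i j h rfl
  intro n
  induction n using Nat.strong_induction_on with | _ n ih =>
  rintro i j h rfl
  refine step i j h fun l hl hli => ih _ ?_ j l hl rfl
  refine Set.ncard_lt_ncard ⟨branchSet_subset hG.isAcyclic h hl hli, fun hsub => ?_⟩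
    (Set.toFinite _)
  exact left_notMem_branchSet (hsub (mem_branchSet_self h.ne))

end IsTree

lemma add_finsum_mem_compl {κ : Type*} [Finite κ] (f : κ → ℤ) (c : κ) :
    f c + ∑ᶠ x ∈ ({c} : Set κ)ᶜ, f x = ∑ᶠ x, f x := by
  rw [← finsum_mem_singleton (f := f) (a := c), ← finsum_mem_union disjoint_compl_right
    (Set.toFinite _) (Set.toFinite _), Set.union_compl_self, finsum_mem_univ]

/-- The sum of `deg` over the vertices of a branch minus the sum of `a` over its edges, including
the edge at which the branch is attached. -/
def branchWeight (deg : ι → ℤ) (a : G.edgeSet → ℤ) (i j : ι) : ℤ :=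
  ∑ᶠ m ∈ branchSet G i j, deg m - ∑ᶠ α ∈ branchEdges G i j, a α

section Weight

variable [Finite ι] (hG : G.IsTree) (deg : ι → ℤ) (a : G.edgeSet → ℤ)
include hG

/-- The two branches at an edge cover the tree, and overlap in this edge. -/
lemma branchWeight_add_branchWeight (h : G.Adj i j) :
    branchWeight deg a i j + branchWeight deg a j i =
      ∑ᶠ m, deg m - ∑ᶠ α, a α - a ⟨s(i, j), h⟩ := by
  have h1 : ∑ᶠ m ∈ branchSet G i j, deg m + ∑ᶠ m ∈ branchSet G j i, deg m = ∑ᶠ m, deg m := by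
    rw [← compl_branchSet hG h, ← finsum_mem_union disjoint_compl_right (Set.toFinite _)
      (Set.toFinite _), Set.union_compl_self, finsum_mem_univ]
  have h2 : ∑ᶠ α, a α + a ⟨s(i, j), h⟩ =
      ∑ᶠ α ∈ branchEdges G i j, a α + ∑ᶠ α ∈ branchEdges G j i, a α := by
    rw [← finsum_mem_union_inter (Set.toFinite _) (Set.toFinite _), branchEdges_union hG h,
      branchEdges_inter hG h, finsum_mem_univ, finsum_mem_singleton]
  unfold branchWeight
  omega

/-- A vertex and the branches attached to it cover the tree. -/
lemma add_finsum_branchWeight (i : ι) :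
    deg i + ∑ᶠ j : G.neighborSet i, branchWeight deg a i j = ∑ᶠ m, deg m - ∑ᶠ α, a α := by
  have h1 : ∑ᶠ j : G.neighborSet i, ∑ᶠ m ∈ branchSet G i j, deg m =
      ∑ᶠ m ∈ ({i} : Set ι)ᶜ, deg m := by
    rw [← iUnion_branchSet hG, finsum_mem_iUnion (pairwise_disjoint_branchSet hG i)
      fun _ => Set.toFinite _]
  have h2 : ∑ᶠ j : G.neighborSet i, ∑ᶠ α ∈ branchEdges G i j, a α = ∑ᶠ α, a α := by
    rw [← finsum_mem_iUnion (pairwise_disjoint_branchEdges hG i) fun _ => Set.toFinite _,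
      iUnion_branchEdges hG, finsum_mem_univ]
  have h3 := add_finsum_mem_compl deg i
  unfold branchWeight
  rw [finsum_sub_distrib (Set.toFinite _) (Set.toFinite _), h1, h2]
  omega

lemma branchWeight_nonneg (hdeg : ∀ {i j : ι} (h : G.Adj i j), a ⟨s(i, j), h⟩ ≤ deg j)
    (h : G.Adj i j) : 0 ≤ branchWeight deg a i j := by
  refine adj_induction hG (P := fun i j => 0 ≤ branchWeight deg a i j) ?_ i j h
  intro i j h ih
  have h1 := branchWeight_add_branchWeight hG deg a h
  have h2 := add_finsum_branchWeight hG deg a j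
  rw [← add_finsum_mem_compl _ ⟨i, h.symm⟩] at h2
  have h3 : 0 ≤ ∑ᶠ l ∈ ({⟨i, h.symm⟩} : Set (G.neighborSet j))ᶜ, branchWeight deg a j l :=
    finsum_nonneg fun l => finsum_nonneg fun hl => ih l l.2 fun h => hl (Subtype.ext h)
  have h4 := hdeg h
  dsimp only at h2
  omega

/-- Numbers `u` on the oriented edges are the branch weights if they are compatible with `deg` at
the vertices and with `a` at the edges. -/
lemma branchWeight_eq {d : ℤ} (u : ∀ i : ι, G.neighborSet i → ℤ)
    (hdeg : ∀ i, deg i = d - ∑ᶠ j, u i j)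
    (ha : ∀ {i j : ι} (h : G.Adj i j), a ⟨s(i, j), h⟩ = d - u i ⟨j, h⟩ - u j ⟨i, h.symm⟩)
    (h : G.Adj i j) : branchWeight deg a i j = u i ⟨j, h⟩ := by
  refine adj_induction hG (P := fun i j => ∀ h : G.Adj i j, branchWeight deg a i j = u i ⟨j, h⟩)
    ?_ i j h h
  intro i j _ ih h
  have h1 := branchWeight_add_branchWeight hG deg a h
  have h2 := add_finsum_branchWeight hG deg a j
  have h5 := hdeg j
  rw [← add_finsum_mem_compl _ ⟨i, h.symm⟩] at h2 h5
  have h3 : ∑ᶠ l ∈ ({⟨i, h.symm⟩} : Set (G.neighborSet j))ᶜ, branchWeight deg a j l =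
      ∑ᶠ l ∈ ({⟨i, h.symm⟩} : Set (G.neighborSet j))ᶜ, u j l :=
    finsum_mem_congr rfl fun l hl => ih l l.2 (fun h => hl (Subtype.ext h)) l.2
  have h4 := ha h
  dsimp only at h2
  omega

/-- The sum of the degrees, corrected at the edges. -/
lemma finsum_sub_finsum_eq {d : ℤ} (u : ∀ i : ι, G.neighborSet i → ℤ)
    (hdeg : ∀ i, deg i = d - ∑ᶠ j, u i j)
    (ha : ∀ {i j : ι} (h : G.Adj i j), a ⟨s(i, j), h⟩ = d - u i ⟨j, h⟩ - u j ⟨i, h.symm⟩) :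
    ∑ᶠ m, deg m - ∑ᶠ α, a α = d := by
  obtain ⟨i⟩ := hG.connected.nonempty
  have h1 := add_finsum_branchWeight hG deg a i
  have h2 : ∑ᶠ j : G.neighborSet i, branchWeight deg a i j = ∑ᶠ j, u i j :=
    finsum_congr fun j => branchWeight_eq hG deg a u hdeg ha j.2
  have h3 := hdeg i
  omega

end Weight

end Tree

namespace CompactTypeCurve

variable {k : Type u} [Field k] {ι : Type v} (C : CompactTypeCurve k ι) {i : ι}

/-- The point is the image of the scheme-theoretic intersection of the two components, which is
closed and consists of a single point. -/
lemma isClosed_pt {j : ι} (h : C.dualGraph.Adj i j) : IsClosed {C.pt h} := by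
  obtain ⟨y, hy⟩ := h.2.choose_spec
  obtain ⟨z, hz, -⟩ := Scheme.Pullback.exists_preimage_pullback (f := C.incl i) (g := C.incl j)
    (C.pt h) y hy
  have := C.isClosedImmersion j
  have hiso := (C.transversal i j h.1).resolve_left fun he => he.elim z
  have hsub : Subsingleton (pullback (C.incl i) (C.incl j) : Scheme.{u}) :=
    (Scheme.homeoOfIso (asIso (pullback.fst (C.incl i) (C.incl j) ≫
      (C.comp i).str))).injective.subsingleton
  have hcl := (pullback.fst (C.incl i) (C.incl j)).isClosedEmbedding.isClosed_range
  convert hcl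
  ext x
  constructor
  · rintro rfl
    exact ⟨z, hz⟩
  · rintro ⟨z', rfl⟩
    rw [Subsingleton.elim z' z]
    exact hz

/-- Distinct neighbours meet `C_i` in distinct points, because no point lies on three components. -/
lemma pt_injective : Function.Injective fun j : C.dualGraph.neighborSet i => C.pt j.2 := by
  intro j l h
  obtain ⟨y, hy⟩ := j.2.2.choose_spec
  obtain ⟨z, hz⟩ := l.2.2.choose_spec
  have h' : C.pt j.2 = C.pt l.2 := h
  have hz' : C.incl i (C.pt j.2) = C.incl l z := h' ▸ hz
  rcases C.no_triple i j l _ y z hy hz' with h1 | h1 | h1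
  · exact absurd h1 j.2.1
  · exact absurd h1 l.2.1
  · exact Subtype.ext h1

end CompactTypeCurve

/-! ### Limit linear series and effective linear series -/

/-- On the classes of two equivalence relations, a relation that is total, and single-valued in both
directions up to equivalence, is a bijection. -/
lemma exists_quot_equiv {α β : Type*} {rα : α → α → Prop} {rβ : β → β → Prop}
    (hβ : Equivalence rβ) (R : α → β → Prop)
    (h₁ : ∀ a, ∃ b, R a b) (h₂ : ∀ b, ∃ a, R a b)
    (hα' : ∀ {a a' b}, rα a a' → R a b → R a' b) (hβ' : ∀ {a b b'}, rβ b b' → R a b → R a b')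
    (huα : ∀ {a a' b}, R a b → R a' b → rα a a') (huβ : ∀ {a b b'}, R a b → R a b' → rβ b b') :
    ∃ Φ : Quot rα ≃ Quot rβ, ∀ a b, Φ (Quot.mk _ a) = Quot.mk _ b ↔ R a b := by
  choose f hf using h₁
  choose g hg using h₂
  refine ⟨⟨Quot.lift (fun a => Quot.mk _ (f a)) fun a a' h =>
      Quot.sound (huβ (hα' h (hf a)) (hf a')),
    Quot.lift (fun b => Quot.mk _ (g b)) fun b b' h => Quot.sound (huα (hβ' h (hg b)) (hg b')),
    ?_, ?_⟩, fun a b => ?_⟩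
  · rintro ⟨a⟩
    exact Quot.sound (huα (hg _) (hf a))
  · rintro ⟨b⟩
    exact Quot.sound (huβ (hf _) (hg b))
  · refine ⟨fun h => hβ' (hβ.eqvGen_iff.mp (Quot.eqvGen_exact h)) (hf a), fun h => ?_⟩
    exact Quot.sound (huβ (hf a) h)

/-- A symmetric function on the oriented edges descends to the edges. -/
lemma exists_eq_on_edges {ι : Type v} {G : SimpleGraph ι} (f : ∀ i j, G.Adj i j → ℤ)
    (hf : ∀ i j h, f i j h = f j i h.symm) :
    ∃ a : G.edgeSet → ℤ, ∀ i j (h : G.Adj i j), a ⟨s(i, j), h⟩ = f i j h := by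
  have key : ∀ α : G.edgeSet, ∃ c, ∀ i j (h : G.Adj i j), α = ⟨s(i, j), h⟩ → c = f i j h := by
    rintro ⟨e, he⟩
    induction e with | h m m' =>
    refine ⟨f m m' he, fun i j h hα => ?_⟩
    rcases Sym2.eq_iff.mp (congrArg Subtype.val hα) with ⟨rfl, rfl⟩ | ⟨rfl, rfl⟩
    · rfl
    · exact hf _ _ _
  choose a ha using key
  exact ⟨a, fun i j h => ha _ i j h rfl⟩

namespace CompactTypeCurve

variable {k : Type u} [Field k] {ι : Type v} (C : CompactTypeCurve k ι)

lemma node_symm {i j : ι} (h : C.dualGraph.Adj i j) : C.node h.symm = C.node h :=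
  Subtype.ext Sym2.eq_swap

end CompactTypeCurve

section Series

variable {k : Type u} [Field k] {ι : Type v} {C : CompactTypeCurve k ι} {r : ℕ} {d : ℤ}
  {S : LimitLinearSeries C r d} {T : EffectiveLinearSeries C r d} {i j : ι}

lemma EffectiveLinearSeries.iso_equivalence :
    Equivalence fun T T' : {T : EffectiveLinearSeries C r d // T.IsRefined} => T.1.Iso T'.1 where
  refl _ := ⟨rfl, fun _ => SmoothCurve.exists_iso_refl _⟩
  symm h := ⟨h.1.symm, fun i => SmoothCurve.exists_iso_symm (h.2 i)⟩
  trans h h' := ⟨h.1.trans h'.1, fun i => SmoothCurve.exists_iso_trans (h.2 i) (h'.2 i)⟩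

/-- The section that vanishes to order at least `a` bounds `w_0` from below on one side of a
node, so that in a refined effective series `w_r = 0` on the other side. -/
lemma EffectiveLinearSeries.IsRefined.w_last [IsAlgClosed k] (hT : T.IsRefined)
    (h : C.dualGraph.Adj i j) :
    T.w h r = 0 := by
  obtain ⟨s, hs, hs0, hle⟩ := T.exists_section h.symm
  obtain ⟨n, hn⟩ := Int.eq_ofNat_of_zero_le
    (le_trans (le_trans (Int.natCast_nonneg r) (T.le_a _)) hle)
  have h1 : n ≤ T.w h.symm 0 := SmoothCurve.le_vanishingOrder_first (T.isLineBundle j)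
    (T.finrank_W j) (C.isClosed_pt h.symm) ⟨s, hs, hs0, hn⟩
  have h2 := hT h.symm 0 (Nat.zero_le r)
  rw [Nat.sub_zero] at h2
  change _ + (T.w h r : ℤ) = _ at h2
  omega

variable [Finite ι]

lemma EffectiveLinearSeries.d'_nonneg (T : EffectiveLinearSeries C r d)
    (h : C.dualGraph.Adj i j) : 0 ≤ T.d' h :=
  branchWeight_nonneg C.isTree T.deg T.a
    (fun h => (congrArg T.a (C.node_symm h)).symm.trans_le (T.a_le_deg h.symm)) h

lemma EffectiveLinearSeries.d'_add_d' (T : EffectiveLinearSeries C r d)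
    (h : C.dualGraph.Adj i j) : T.d' h + T.d' h.symm = d - T.a (C.node h) := by
  have h1 := branchWeight_add_branchWeight C.isTree T.deg T.a h
  rw [T.sum_deg] at h1
  exact h1

lemma EffectiveLinearSeries.deg_add_finsum_d' (T : EffectiveLinearSeries C r d)
    (i : ι) : T.deg i + ∑ᶠ j : C.dualGraph.neighborSet i, T.d' j.2 = d :=
  (add_finsum_branchWeight C.isTree T.deg T.a i).trans T.sum_deg

lemma IsEffectiveOf.of_iso_left {S' : LimitLinearSeries C r d} (hi : S.Iso S')
    (h : IsEffectiveOf S T) : IsEffectiveOf S' T := by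
  have hu : ∀ {i j : ι} (h : C.dualGraph.Adj i j), S.u h r = S'.u h r := fun {i j} h =>
    SmoothCurve.vanishingOrder_eq_of_iso (S.isLineBundle i) (hi i) _ _ _
  refine ⟨fun i => ?_, fun h' => ?_⟩
  · convert (h.1 i).of_iso_left C.pt_injective (fun j => C.isClosed_pt j.2)
      (S.isLineBundle i) (hi i) using 2 with j
    exact (hu j.2).symm
  · rw [h.2 h', hu, hu]

lemma IsEffectiveOf.of_iso_right {T' : EffectiveLinearSeries C r d} (hi : T.Iso T')
    (h : IsEffectiveOf S T) : IsEffectiveOf S T' :=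
  ⟨fun i => (h.1 i).of_iso_right C.pt_injective (fun j => C.isClosed_pt j.2)
    (S.isLineBundle i) (hi.2 i), fun h' => hi.1 ▸ h.2 h'⟩

lemma IsEffectiveOf.unique_right {T' : EffectiveLinearSeries C r d}
    (h : IsEffectiveOf S T) (h' : IsEffectiveOf S T') : T.Iso T' := by
  refine ⟨?_, fun i => (h.1 i).unique_right C.pt_injective (fun j => C.isClosed_pt j.2)
    (S.isLineBundle i) (h'.1 i)⟩
  ext ⟨e, he⟩
  induction e with | h i j =>
  exact (h.2 he).trans (h'.2 he).symm

lemma IsLimitOf.unique {S' : LimitLinearSeries C r d}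
    (h : IsLimitOf T S) (h' : IsLimitOf T S') : S.Iso S' := fun i =>
  (h.2 i).unique_left C.pt_injective (fun j => C.isClosed_pt j.2)
    (S.isLineBundle i) (S'.isLineBundle i) (h'.2 i)

variable [IsAlgClosed k]

/-- A twist shifts the orders of vanishing at the nodes. -/
lemma u_eq_w_add {n : ∀ i, C.dualGraph.neighborSet i → ℕ}
    (hST : (C.comp i).IsTwist (fun j : C.dualGraph.neighborSet i => C.pt j.2) (n i) (S.L i) (S.V i)
      (T.L i) (T.W i)) (h : C.dualGraph.Adj i j) (t : ℕ) :
    S.u h t = T.w h t + n i ⟨j, h⟩ :=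
  hST.vanishingOrder_eq (S.isLineBundle i) C.pt_injective (fun j => C.isClosed_pt j.2)
    (S.finrank_V i) ⟨j, h⟩ t

/-- The two constructions are inverse to one another. In both directions the multiplicities of the
twists agree: `d'_{i,α} = u_r(i,α)`. -/
lemma isEffectiveOf_iff_isLimitOf (hT : T.IsRefined) : IsEffectiveOf S T ↔ IsLimitOf T S := by
  constructor
  · rintro ⟨h1, h2⟩
    have hdeg : ∀ i, T.deg i = d - ∑ᶠ j : C.dualGraph.neighborSet i, (S.u j.2 r : ℤ) := fun i =>
      SmoothCurve.HasDegree.unique (T.isLineBundle i) (T.hasDegree i)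
        (((h1 i).hasDegree_iff (S.isLineBundle i) C.pt_injective
          (fun j => C.isClosed_pt j.2) d).mp (S.hasDegree i))
    have hd' : ∀ i (j : C.dualGraph.neighborSet i), T.d' j.2 = S.u j.2 r := fun i j =>
      branchWeight_eq C.isTree T.deg T.a (fun i j => (S.u j.2 r : ℤ)) hdeg h2 j.2
    refine ⟨T.d'_nonneg, fun i => ?_⟩
    convert h1 i with j
    rw [hd', Int.toNat_natCast]
  · rintro ⟨h1, h2⟩
    have hu : ∀ {i j : ι} (h : C.dualGraph.Adj i j), S.u h r = (T.d' h).toNat := fun {i j} h => by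
      rw [u_eq_w_add (n := fun i j => (T.d' j.2).toNat) (h2 i) h r, hT.w_last h, zero_add]
    refine ⟨fun i => ?_, fun {i j} h => ?_⟩
    · convert h2 i with j
      exact hu j.2
    · rw [hu, hu, Int.toNat_of_nonneg (h1 h), Int.toNat_of_nonneg (h1 h.symm)]
      have := T.d'_add_d' h
      omega

/-- A refined limit series has an effective series. As the twists by `u_r` remove all base points at
the nodes, `a_α` becomes the greatest order of vanishing on either side of the node; this yields
the sections vanishing to order at least `a_α` and the bounds on `a_α`. -/
lemma exists_isEffectiveOf (hS : S.IsRefined) :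
    ∃ T : EffectiveLinearSeries C r d, T.IsRefined ∧ IsEffectiveOf S T := by
  have hex : ∀ i, ∃ (L' : (C.comp i).X.Modules) (V' : Submodule k ((C.comp i).H0 L')),
      IsLineBundle L' ∧ (C.comp i).IsTwist (κ := C.dualGraph.neighborSet i)
        (fun j => C.pt j.2) (fun j => S.u j.2 r) (S.L i) (S.V i) L' V' := fun i => by
    refine SmoothCurve.exists_isTwist_sub (S.isLineBundle i) C.pt_injective
      (fun j => C.isClosed_pt j.2) fun s hs hs0 j => ?_
    obtain ⟨ρ, D, hD⟩ := SmoothCurve.exists_rationalEmbedding_hasDivisor (S.isLineBundle i)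
    obtain ⟨n, hn⟩ := Int.eq_ofNat_of_zero_le (hD.ord_nonneg hs0 (C.pt j.2))
    rw [hn]
    exact Int.ofNat_le.mpr (SmoothCurve.vanishingOrder_last_le ⟨s, hs, hs0, hn⟩)
  choose L W hL hT using hex
  obtain ⟨a, ha⟩ := exists_eq_on_edges (G := C.dualGraph)
    (fun i j h => d - S.u h r - S.u h.symm r) fun i j h => by omega
  have hdegL : ∀ i, HasDegree (L i) (d - ∑ᶠ j : C.dualGraph.neighborSet i, (S.u j.2 r : ℤ)) :=
    fun i => ((hT i).hasDegree_iff (S.isLineBundle i) C.pt_injective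
      (fun j => C.isClosed_pt j.2) d).mp (S.hasDegree i)
  have hW : ∀ i, Module.finrank k (W i) = r + 1 := fun i =>
    (hT i).finrank_eq.symm.trans (S.finrank_V i)
  have hw : ∀ {i j : ι} (h : C.dualGraph.Adj i j) (t : ℕ),
      S.u h t = (C.comp i).vanishingOrder (W i) (C.pt h) r t + S.u h r := fun {i j} h t =>
    (hT i).vanishingOrder_eq (S.isLineBundle i) C.pt_injective (fun j => C.isClosed_pt j.2)
      (S.finrank_V i) ⟨j, h⟩ t
  have hadd : ∀ {i j : ι} (h : C.dualGraph.Adj i j) (t : ℕ), t ≤ r →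
      ((C.comp i).vanishingOrder (W i) (C.pt h) r t : ℤ)
        + (C.comp j).vanishingOrder (W j) (C.pt h.symm) r (r - t) = a (C.node h) :=
    fun {i j} h t ht => by
    have h1 := hS h t ht
    have h2 := hw h t
    have h3 := hw h.symm (r - t)
    have h4 : a (C.node h) = _ := ha i j h
    omega
  -- The order `w_r` vanishes, so refinedness at `t = 0` reads `a = w_0`.
  have ha0 : ∀ {i j : ι} (h : C.dualGraph.Adj i j),
      a (C.node h) = (C.comp i).vanishingOrder (W i) (C.pt h) r 0 := fun {i j} h => by
    have h1 := hadd h 0 (Nat.zero_le r)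
    have h2 := hw h.symm r
    rw [Nat.sub_zero] at h1
    omega
  have hsec : ∀ {i j : ι} (h : C.dualGraph.Adj i j),
      ∃ s ∈ W i, s ≠ 0 ∧ (C.comp i).ord s (C.pt h) = a (C.node h) := fun {i j} h => by
    rw [ha0 h]
    exact SmoothCurve.vanishingOrder_mem (hL i) (hW i) (C.isClosed_pt h) 0
  let T : EffectiveLinearSeries C r d :=
    { L := L
      isLineBundle := hL
      deg := fun i => d - ∑ᶠ j : C.dualGraph.neighborSet i, (S.u j.2 r : ℤ)
      hasDegree := hdegL
      W := W
      finrank_W := hW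
      a := a
      le_a := by
        rintro ⟨e, he⟩
        induction e with | h i j =>
        refine le_of_le_of_eq ?_ (ha0 he).symm
        exact Int.ofNat_le.mpr
          (SmoothCurve.le_vanishingOrder_zero (hL i) (hW i) (C.isClosed_pt he))
      a_le_deg := fun {i j} h => by
        obtain ⟨s, -, hs0, hs⟩ := hsec h
        rw [← hs]
        exact SmoothCurve.HasDegree.ord_le (hL i) (hdegL i) hs0 _
      sum_deg := finsum_sub_finsum_eq C.isTree _ a (fun i j => (S.u j.2 r : ℤ)) (fun _ => rfl)
        fun h => ha _ _ h
      le_add := fun h t ht => (hadd h t ht).ge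
      exists_section := fun {i j} h => by
        obtain ⟨s, hs, hs0, hle⟩ := hsec h
        exact ⟨s, hs, hs0, hle.ge⟩ }
  exact ⟨T, hadd, hT, fun h => ha _ _ h⟩

lemma exists_isLimitOf (hT : T.IsRefined) :
    ∃ S : LimitLinearSeries C r d, S.IsRefined ∧ IsLimitOf T S := by
  have hex := fun i => SmoothCurve.exists_isTwist_add (T.isLineBundle i)
    (C.pt_injective (i := i)) (fun j => C.isClosed_pt j.2)
    (fun j : C.dualGraph.neighborSet i => (T.d' j.2).toNat) (T.W i)
  choose L V hL hS using hex
  have hV : ∀ i, Module.finrank k (V i) = r + 1 := fun i =>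
    (hS i).finrank_eq.trans (T.finrank_W i)
  have hu : ∀ {i j : ι} (h : C.dualGraph.Adj i j) (t : ℕ),
      (C.comp i).vanishingOrder (V i) (C.pt h) r t = T.w h t + T.d' h := fun {i j} h t => by
    have := (hS i).vanishingOrder_eq (hL i) C.pt_injective (fun j => C.isClosed_pt j.2)
      (hV i) ⟨j, h⟩ t
    rw [this, Nat.cast_add, Int.toNat_of_nonneg (T.d'_nonneg h)]
    rfl
  have hadd : ∀ {i j : ι} (h : C.dualGraph.Adj i j) (t : ℕ), t ≤ r →
      ((C.comp i).vanishingOrder (V i) (C.pt h) r t : ℤ)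
        + (C.comp j).vanishingOrder (V j) (C.pt h.symm) r (r - t) = d := fun {i j} h t ht => by
    have h1 := hT h t ht
    have h2 := T.d'_add_d' h
    rw [hu h, hu h.symm]
    omega
  let S : LimitLinearSeries C r d :=
    { L := L
      isLineBundle := hL
      hasDegree := fun i => by
        rw [(hS i).hasDegree_iff (hL i) C.pt_injective (fun j => C.isClosed_pt j.2)]
        convert T.hasDegree i
        rw [finsum_congr fun j : C.dualGraph.neighborSet i =>
          Int.toNat_of_nonneg (T.d'_nonneg j.2), sub_eq_iff_eq_add]
        exact (T.deg_add_finsum_d' i).symm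
      V := V
      finrank_V := hV
      le_add := fun h t ht => (hadd h t ht).ge }
  exact ⟨S, hadd, T.d'_nonneg, hS⟩

end Series

end LimitSeries

end

theorem proposition3p3 {k : Type u} [Field k] [IsAlgClosed k] {ι : Type v} [Finite ι]
    (C : LimitSeries.CompactTypeCurve k ι) (r : ℕ) (d : ℤ) :
    ∃ Φ : LimitSeries.RefinedLimitClasses C r d ≃ LimitSeries.RefinedEffectiveClasses C r d,
      (∀ S T, Φ (Quot.mk _ S) = Quot.mk _ T ↔ LimitSeries.IsEffectiveOf S.1 T.1) ∧
      (∀ S T, Φ.symm (Quot.mk _ T) = Quot.mk _ S ↔ LimitSeries.IsLimitOf T.1 S.1) := by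
  let A := {S : LimitSeries.LimitLinearSeries C r d // S.IsRefined}
  let B := {T : LimitSeries.EffectiveLinearSeries C r d // T.IsRefined}
  have iff (S : A) (T : B) : LimitSeries.IsEffectiveOf S.1 T.1 ↔ LimitSeries.IsLimitOf T.1 S.1 :=
    LimitSeries.isEffectiveOf_iff_isLimitOf T.2
  have h1 (S : A) : ∃ T : B, LimitSeries.IsEffectiveOf S.1 T.1 :=
    let ⟨T, hT, h⟩ := LimitSeries.exists_isEffectiveOf S.2
    ⟨⟨T, hT⟩, h⟩
  have h2 (T : B) : ∃ S : A, LimitSeries.IsEffectiveOf S.1 T.1 :=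
    let ⟨S, hS, h⟩ := LimitSeries.exists_isLimitOf T.2
    ⟨⟨S, hS⟩, (iff ⟨S, hS⟩ T).mpr h⟩
  have h3 (S S' : A) (T : B) (hi : S.1.Iso S'.1) (h : LimitSeries.IsEffectiveOf S.1 T.1) :
      LimitSeries.IsEffectiveOf S'.1 T.1 := LimitSeries.IsEffectiveOf.of_iso_left hi h
  have h4 (S : A) (T T' : B) (hi : T.1.Iso T'.1) (h : LimitSeries.IsEffectiveOf S.1 T.1) :
      LimitSeries.IsEffectiveOf S.1 T'.1 := LimitSeries.IsEffectiveOf.of_iso_right hi h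
  have h5 (S S' : A) (T : B) (h : LimitSeries.IsEffectiveOf S.1 T.1)
      (h' : LimitSeries.IsEffectiveOf S'.1 T.1) : S.1.Iso S'.1 :=
    LimitSeries.IsLimitOf.unique ((iff S T).mp h) ((iff S' T).mp h')
  have h6 (S : A) (T T' : B) (h : LimitSeries.IsEffectiveOf S.1 T.1)
      (h' : LimitSeries.IsEffectiveOf S.1 T'.1) : T.1.Iso T'.1 :=
    LimitSeries.IsEffectiveOf.unique_right h h'
  obtain ⟨Φ, hΦ⟩ := LimitSeries.exists_quot_equiv
    LimitSeries.EffectiveLinearSeries.iso_equivalence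
    (fun (S : A) (T : B) => LimitSeries.IsEffectiveOf S.1 T.1)
    (rα := fun S S' => S.1.Iso S'.1) h1 h2 (h3 _ _ _) (h4 _ _ _) (h5 _ _ _) (h6 _ _ _)
  refine ⟨Φ, hΦ, fun S T => ?_⟩
  exact (Equiv.symm_apply_eq Φ).trans (eq_comm.trans ((hΦ S T).trans (iff S T)))
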